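/- Let $\Phi,\xi:\mathbb R\to\mathbb R$ be convex, $C^\infty$ and even, with $\Phi(0)=\xi(0)=0$. Let $M>0$ and assume that $\Phi$ has moderate growth in the sense that $\mathbb E\exp\bigl(M\,\Phi(x+\zeta)\bigr)<\infty$ for every $x\in\mathbb R$, where $\zeta$ is a centred Gaussian variable with variance $\xi'(1)$. Let $h\in\mathbb R$, $k\ge 1$ and $0=q_0\le q_1\le\dots\le q_k\le q_{k+1}=1$, and let $z_0,\dots,z_k$ be independent centred Gaussian variables with $\mathbb E z_p^2=\xi'(q_{p+1})-\xi'(q_p)$. For a vector $\vec m=(m_0,\dots,m_k)$ with $0=m_0\le m_1\le\dots\le m_k\le M$, put $\Phi_{k+1}=\Phi$ and, for $0\le p\le k$, $$\Phi_p(x)=\frac1{m_p}\log\mathbb E\exp\bigl(m_p\Phi_{p+1}(x+z_p)\bigr),\qquad\text{read as }\Phi_p(x)=\mathbb E\,\Phi_{p+1}(x+z_p)\text{ if }m_p=0.$$ Let $Z_p=h+z_0+\dots+z_{p-1}$, $Z=Z_{k+1}$, $X_p=\Phi_p(Z_p)$, $W_p=\exp\bigl(m_p(X_{p+1}-X_p)\bigr)$,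 let $\mathbb E_p$ denote the expectation in the variables $(z_i)_{i\ge p}$ with the other variables fixed, and for $1\le l\le k$ let $$U_l=U_l(\vec m)=\mathbb E\,W_1\cdots W_{l-1}\bigl(\mathbb E_l\,W_l\cdots W_k\,\Phi'(Z)\bigr)^2 .$$ Then, for every $1\le l\le k$, all the integrals in these definitions converge for every such $\vec m$, and $U_l$ is nondecreasing in each $m_j$, $1\le j\le k$: if $\vec m$ and $\vec m'$ are two such vectors with $m_j\le m'_j$ that agree in all coordinates other than the $j$-th, then $U_l(\vec m)\le U_l(\vec m')$. -/

import Mathlib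

open MeasureTheory ProbabilityTheory
open scoped ContDiff NNReal

noncomputable section

namespace Parisi

/-- The standing assumptions on each of the two functions `Φ` and `ξ`: convex, smooth, even, and
vanishing at the origin. -/
structure IsAdmissible (f : ℝ → ℝ) : Prop where
  convex : ConvexOn ℝ Set.univ f
  smooth : ContDiff ℝ ∞ f
  even : ∀ x, f (-x) = f x
  zero : f 0 = 0

/-- `0 = q_0 ≤ q_1 ≤ … ≤ q_k ≤ q_{k+1} = 1` (only the entries of index at most `k + 1` matter). -/
structure IsPartition (k : ℕ) (q : ℕ → ℝ) : Prop where
  zero : q 0 = 0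
  mono : ∀ i ≤ k, q i ≤ q (i + 1)
  last : q (k + 1) = 1

/-- `0 = m_0 ≤ m_1 ≤ … ≤ m_k ≤ M` (only the entries of index at most `k` matter). -/
structure IsOrderSeq (k : ℕ) (M : ℝ) (m : ℕ → ℝ) : Prop where
  zero : m 0 = 0
  mono : ∀ i < k, m i ≤ m (i + 1)
  le : m k ≤ M

/-- The moderate growth assumption on `Φ` for parameters `m_j ∈ [0, M]`: the exponential integrals
`E exp (M Φ(x + z))` are finite for all `x`, where `z` is centred Gaussian with variance `ξ'(1)`
(the law of `z_0 + … + z_k`). -/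
def ModerateGrowth (Φ ξ : ℝ → ℝ) (M : ℝ) : Prop :=
  ∀ x : ℝ, Integrable (fun z : ℝ => Real.exp (M * Φ (x + z)))
    (gaussianReal 0 (deriv ξ 1).toNNReal)

/-- `E z_l² = ξ'(q_{l+1}) - ξ'(q_l)`; this is nonnegative for convex `ξ` and monotone `q`. -/
def incrVar (ξ : ℝ → ℝ) (q : ℕ → ℝ) (l : ℕ) : ℝ≥0 :=
  (deriv ξ (q (l + 1)) - deriv ξ (q l)).toNNReal

/-- One step of the recursion: `x ↦ (1/m) log E exp (m f(x + z))` with `z` centred Gaussian of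
variance `v`, read as `x ↦ E f(x + z)` when `m = 0`. -/
def step (m : ℝ) (v : ℝ≥0) (f : ℝ → ℝ) (x : ℝ) : ℝ :=
  if m = 0 then ∫ z, f (x + z) ∂(gaussianReal 0 v)
  else (1 / m) * Real.log (∫ z, Real.exp (m * f (x + z)) ∂(gaussianReal 0 v))

/-- `phiRev … n` is `Φ_{k+1-n}`: start from `Φ_{k+1} = Φ` and go down `n` levels. -/
def phiRev (k : ℕ) (Φ ξ : ℝ → ℝ) (q m : ℕ → ℝ) : ℕ → ℝ → ℝ
  | 0 => Φ
  | n + 1 => step (m (k - n)) (incrVar ξ q (k - n)) (phiRev k Φ ξ q m n)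

/-- The functions `Φ_l`, `0 ≤ l ≤ k + 1`. -/
def phi (k : ℕ) (Φ ξ : ℝ → ℝ) (q m : ℕ → ℝ) (l : ℕ) : ℝ → ℝ :=
  phiRev k Φ ξ q m (k + 1 - l)

theorem phi_last (k : ℕ) (Φ ξ : ℝ → ℝ) (q m : ℕ → ℝ) : phi k Φ ξ q m (k + 1) = Φ := by
  simp [phi, phiRev]

theorem phi_of_le (k : ℕ) (Φ ξ : ℝ → ℝ) (q m : ℕ → ℝ) {l : ℕ} (hl : l ≤ k) :
    phi k Φ ξ q m l = step (m l) (incrVar ξ q l) (phi k Φ ξ q m (l + 1)) := by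
  have h1 : k + 1 - l = (k - l) + 1 := by omega
  have h2 : k + 1 - (l + 1) = k - l := by omega
  have h3 : k - (k - l) = l := by omega
  simp only [phi, h1, h2, phiRev, h3]

/-- The joint law of the independent centred Gaussian variables `z_0, …, z_k`. -/
def law (k : ℕ) (ξ : ℝ → ℝ) (q : ℕ → ℝ) : Measure (Fin (k + 1) → ℝ) :=
  Measure.pi fun i => gaussianReal 0 (incrVar ξ q i)

/-- The configuration that keeps `z_i` for `i < l` and takes `w_i` for `i ≥ l`. -/
def splice {k : ℕ} (l : ℕ) (z w : Fin (k + 1) → ℝ) : Fin (k + 1) → ℝ :=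
  fun i => if (i : ℕ) < l then z i else w i

/-- `E_l F`: the expectation of `F` in the variables `(z_i)_{i ≥ l}`, the others being fixed. -/
def partialExp (k : ℕ) (ξ : ℝ → ℝ) (q : ℕ → ℝ) (l : ℕ) (F : (Fin (k + 1) → ℝ) → ℝ)
    (z : Fin (k + 1) → ℝ) : ℝ :=
  ∫ w, F (splice l z w) ∂(law k ξ q)

/-- `Z_l = h + z_0 + … + z_{l-1}`; in particular `Z = Z_{k+1}`. -/
def Z {k : ℕ} (h : ℝ) (l : ℕ) (z : Fin (k + 1) → ℝ) : ℝ :=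
  h + ∑ i : Fin (k + 1), if (i : ℕ) < l then z i else 0

/-- `X_l = Φ_l(Z_l)`. -/
def X (k : ℕ) (Φ ξ : ℝ → ℝ) (h : ℝ) (q m : ℕ → ℝ) (l : ℕ) (z : Fin (k + 1) → ℝ) : ℝ :=
  phi k Φ ξ q m l (Z h l z)

/-- `W_l = exp (m_l (X_{l+1} - X_l))`. -/
def W (k : ℕ) (Φ ξ : ℝ → ℝ) (h : ℝ) (q m : ℕ → ℝ) (l : ℕ) (z : Fin (k + 1) → ℝ) : ℝ :=
  Real.exp (m l * (X k Φ ξ h q m (l + 1) z - X k Φ ξ h q m l z))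

/-- `W_l ⋯ W_k Φ'(Z)`. -/
def inner (k : ℕ) (Φ ξ : ℝ → ℝ) (h : ℝ) (q m : ℕ → ℝ) (l : ℕ) (z : Fin (k + 1) → ℝ) : ℝ :=
  (∏ p ∈ Finset.Icc l k, W k Φ ξ h q m p z) * deriv Φ (Z h (k + 1) z)

/-- `W_1 ⋯ W_{l-1} (E_l W_l ⋯ W_k Φ'(Z))²`. -/
def outer (k : ℕ) (Φ ξ : ℝ → ℝ) (h : ℝ) (q m : ℕ → ℝ) (l : ℕ) (z : Fin (k + 1) → ℝ) : ℝ :=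
  (∏ p ∈ Finset.Ico 1 l, W k Φ ξ h q m p z) *
    (partialExp k ξ q l (inner k Φ ξ h q m l) z) ^ 2

/-- `U_l = E W_1 ⋯ W_{l-1} (E_l W_l ⋯ W_k Φ'(Z))²`. -/
def U (k : ℕ) (Φ ξ : ℝ → ℝ) (h : ℝ) (q m : ℕ → ℝ) (l : ℕ) : ℝ :=
  ∫ z, outer k Φ ξ h q m l z ∂(law k ξ q)

/-- All the integrals that enter the definition of `U_l` converge. -/
structure WellDefined (k : ℕ) (Φ ξ : ℝ → ℝ) (h : ℝ) (q m : ℕ → ℝ) (l : ℕ) : Prop where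
  phi_integrable : ∀ p ≤ k, ∀ x : ℝ,
    Integrable (fun z => phi k Φ ξ q m (p + 1) (x + z)) (gaussianReal 0 (incrVar ξ q p))
  exp_integrable : ∀ p ≤ k, ∀ x : ℝ,
    Integrable (fun z => Real.exp (m p * phi k Φ ξ q m (p + 1) (x + z)))
      (gaussianReal 0 (incrVar ξ q p))
  inner_integrable : ∀ z : Fin (k + 1) → ℝ,
    Integrable (fun w => inner k Φ ξ h q m l (splice l z w)) (law k ξ q)
  outer_integrable : Integrable (outer k Φ ξ h q m l) (law k ξ q)

end Parisi

end

/-! For a function f and a parameter m, let T g(x) be the mean of g(x + z) under the Gaussian law of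
z tilted by exp(m f(x + z)). Differentiating the recursion gives Φ_p' = T Φ_{p+1}', and W_p is
exactly the normalised tilting density at level p. Hence Φ_p'(Z_p) is a martingale under these
densities, E_l W_l ⋯ W_k Φ'(Z) = Φ_l'(Z_l), and, as W_0 = 1, U_l is the iterated tilted mean of
(Φ_l')² over the levels l-1, …, 0, evaluated at h.

It remains to see that tilted means grow with m. Shifting the Gaussian by x and folding y with -y
turns T g(x), for even g, into a mean of g with weight exp(m f(y)) cosh(xy/v). If 0 ≤ x ≤ x' and
m'f' - mf is nondecreasing in |y|, the ratio of the primed weight to the unprimed one is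
nondecreasing in |y|, so Chebyshev's association inequality raises the mean of every g nondecreasing
in |y| (`tilt_le_of_even`). For odd d, sinh = tanh · cosh reduces the claim to the even function
d(y) tanh(xy/v) (`tilt_le_of_odd`). When 0 ≤ m ≤ m', the condition on m'f' - mf follows from f'
having the larger derivative on the half-line. Downward induction therefore compares first the
derivatives (`IsRecursion.deriv_le`), then the iterated means (`IsRecursion.tiltIter_le`).

Convergence rests on exp(M Φ_p) being at most the Gaussian average of exp(M Φ_{p+1})
(`HasGrowth.exp_mul_step_le`): integrability at variance V + v descends to variance V one level
lower. -/

noncomputable section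

namespace Parisi

/-! ### Even functions that are nondecreasing on the half-line -/

/-- `g` is a nondecreasing function of the absolute value. -/
def AbsMono (g : ℝ → ℝ) : Prop := ∀ x y, |x| ≤ |y| → g x ≤ g y

theorem AbsMono.even {g : ℝ → ℝ} (hg : AbsMono g) (x : ℝ) : g (-x) = g x :=
  le_antisymm (hg _ _ (by simp)) (hg _ _ (by simp))

theorem AbsMono.apply_abs {g : ℝ → ℝ} (hg : AbsMono g) (x : ℝ) : g |x| = g x :=
  le_antisymm (hg _ _ (by simp)) (hg _ _ (by simp))

theorem AbsMono.of_even {g : ℝ → ℝ} (he : ∀ x, g (-x) = g x)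
    (hm : ∀ x y, 0 ≤ x → x ≤ y → g x ≤ g y) : AbsMono g := by
  have habs : ∀ x, g |x| = g x := fun x => by
    rcases abs_choice x with h | h <;> rw [h]
    exact he x
  intro x y hxy
  rw [← habs x, ← habs y]
  exact hm _ _ (abs_nonneg x) hxy

theorem AbsMono.measurable {g : ℝ → ℝ} (hg : AbsMono g) : Measurable g := by
  have h1 : Monotone fun x : ℝ => g (max x 0) := fun x y hxy => by
    apply hg
    rw [abs_of_nonneg (le_max_right x 0), abs_of_nonneg (le_max_right y 0)]
    exact max_le_max hxy le_rfl
  have h2 : g = (fun x : ℝ => g (max x 0)) ∘ fun x => |x| := by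
    funext x
    simp [hg.apply_abs]
  rw [h2]
  exact h1.measurable.comp measurable_abs

theorem AbsMono.mul {g f : ℝ → ℝ} (hg : AbsMono g) (hf : AbsMono f) (hg0 : ∀ x, 0 ≤ g x)
    (hf0 : ∀ x, 0 ≤ f x) : AbsMono fun x => g x * f x := fun x y hxy =>
  mul_le_mul (hg x y hxy) (hf x y hxy) (hf0 x) (hg0 y)

theorem AbsMono.exp {g : ℝ → ℝ} (hg : AbsMono g) : AbsMono fun x => Real.exp (g x) :=
  fun x y hxy => Real.exp_le_exp.2 (hg x y hxy)

theorem AbsMono.const_mul {g : ℝ → ℝ} (hg : AbsMono g) {c : ℝ} (hc : 0 ≤ c) :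
    AbsMono fun x => c * g x := fun x y hxy => mul_le_mul_of_nonneg_left (hg x y hxy) hc

theorem absMono_of_odd {d : ℝ → ℝ} (ho : ∀ x, d (-x) = -d x) (hm : Monotone d) :
    AbsMono fun x => |d x| := by
  have h0 : d 0 = 0 := by have := ho 0; simp at this; linarith
  refine AbsMono.of_even (fun x => by rw [ho, abs_neg]) fun x y hx hxy => ?_
  have h1 : 0 ≤ d x := h0 ▸ hm hx
  have h2 : 0 ≤ d y := h0 ▸ hm (hx.trans hxy)
  rw [abs_of_nonneg h1, abs_of_nonneg h2]
  exact hm hxy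

theorem odd_zero {d : ℝ → ℝ} (ho : ∀ x, d (-x) = -d x) : d 0 = 0 := by
  have := ho 0; simp at this; linarith

/-! ### Hyperbolic quotients -/

/-- Product-to-sum leaves two comparisons of cosh: ta + sb ≤ tb + sa since (t - s)(b - a) ≥ 0, and
|ta - sb| ≤ tb - sa. This is the monotone likelihood ratio of the folded Gaussian in its shift. -/
theorem cosh_mul_cosh_le {s t : ℝ} (hs : 0 ≤ s) (hst : s ≤ t) {a b : ℝ} (ha : 0 ≤ a)
    (hab : a ≤ b) :
    Real.cosh (t * a) * Real.cosh (s * b) ≤ Real.cosh (t * b) * Real.cosh (s * a) := by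
  have key : ∀ u w : ℝ, Real.cosh u * Real.cosh w
      = (Real.cosh (u + w) + Real.cosh (u - w)) / 2 := fun u w => by
    rw [Real.cosh_add, Real.cosh_sub]; ring
  have p1 : 0 ≤ s * (b - a) := mul_nonneg hs (sub_nonneg.2 hab)
  have p2 : 0 ≤ (t - s) * a := mul_nonneg (sub_nonneg.2 hst) ha
  have p3 : 0 ≤ (t - s) * (b - a) := mul_nonneg (sub_nonneg.2 hst) (sub_nonneg.2 hab)
  have p4 : 0 ≤ s * a := mul_nonneg hs ha
  have e1 : Real.cosh (t * a + s * b) ≤ Real.cosh (t * b + s * a) := by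
    rw [Real.cosh_le_cosh, abs_of_nonneg (by nlinarith), abs_of_nonneg (by nlinarith)]
    nlinarith
  have e2 : Real.cosh (t * a - s * b) ≤ Real.cosh (t * b - s * a) := by
    rw [Real.cosh_le_cosh, abs_of_nonneg (a := t * b - s * a) (by nlinarith), abs_le]
    constructor <;> nlinarith
  rw [key, key]
  linarith

theorem absMono_cosh_div {s t : ℝ} (hs : 0 ≤ s) (hst : s ≤ t) :
    AbsMono fun y => Real.cosh (t * y) / Real.cosh (s * y) := by
  refine AbsMono.of_even (fun x => by simp) fun x y hx hxy => ?_
  rw [div_le_div_iff₀ (Real.cosh_pos _) (Real.cosh_pos _)]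
  exact cosh_mul_cosh_le hs hst hx hxy

theorem tanh_monotone : Monotone Real.tanh := by
  intro a b hab
  rw [Real.tanh_eq_sinh_div_cosh, Real.tanh_eq_sinh_div_cosh,
    div_le_div_iff₀ (Real.cosh_pos _) (Real.cosh_pos _)]
  have h : 0 ≤ Real.sinh (b - a) := Real.sinh_nonneg_iff.2 (sub_nonneg.2 hab)
  rw [Real.sinh_sub] at h
  linarith

/-! ### Association on the half-line -/

/-- Chebyshev's association inequality for functions nondecreasing in the absolute value. -/
theorem AbsMono.chebyshev {μ : Measure ℝ} {a b w : ℝ → ℝ} [SFinite μ]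
    (ha : AbsMono a) (hb : AbsMono b) (hw : ∀ y, 0 ≤ w y)
    (i1 : Integrable w μ) (i2 : Integrable (fun y => a y * w y) μ)
    (i3 : Integrable (fun y => b y * w y) μ) (i4 : Integrable (fun y => a y * (b y * w y)) μ) :
    (∫ y, a y * w y ∂μ) * (∫ y, b y * w y ∂μ) ≤
      (∫ y, a y * (b y * w y) ∂μ) * ∫ y, w y ∂μ := by
  -- The integrand is (a(p₁) - a(p₂))(b(p₁) - b(p₂)) w(p₁) w(p₂), expanded; its integral is twice
  -- the difference of the two sides.
  have h0 : 0 ≤ ∫ p : ℝ × ℝ, ((a p.1 * (b p.1 * w p.1)) * w p.2 - (a p.1 * w p.1) * (b p.2 * w p.2)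
      - (b p.1 * w p.1) * (a p.2 * w p.2) + w p.1 * (a p.2 * (b p.2 * w p.2))) ∂(μ.prod μ) := by
    refine integral_nonneg fun p => ?_
    have h1 : 0 ≤ (a p.1 - a p.2) * (b p.1 - b p.2) := by
      rcases le_total |p.1| |p.2| with h | h
      · exact mul_nonneg_of_nonpos_of_nonpos (sub_nonpos.2 (ha _ _ h)) (sub_nonpos.2 (hb _ _ h))
      · exact mul_nonneg (sub_nonneg.2 (ha _ _ h)) (sub_nonneg.2 (hb _ _ h))
    have h2 := mul_nonneg h1 (mul_nonneg (hw p.1) (hw p.2))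
    simp only [Pi.zero_apply]
    linarith
  have j1 := i4.mul_prod i1
  have j2 := i2.mul_prod i3
  have j3 := i3.mul_prod i2
  have j4 := i1.mul_prod i4
  have j12 : Integrable (fun p : ℝ × ℝ => (a p.1 * (b p.1 * w p.1)) * w p.2
      - (a p.1 * w p.1) * (b p.2 * w p.2)) (μ.prod μ) := j1.sub j2
  have j123 : Integrable (fun p : ℝ × ℝ => (a p.1 * (b p.1 * w p.1)) * w p.2
      - (a p.1 * w p.1) * (b p.2 * w p.2) - (b p.1 * w p.1) * (a p.2 * w p.2)) (μ.prod μ) :=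
    j12.sub j3
  rw [integral_add j123 j4, integral_sub j12 j3, integral_sub j1 j2] at h0
  rw [integral_prod_mul (fun y => a y * (b y * w y)) w,
    integral_prod_mul (fun y => a y * w y) (fun y => b y * w y),
    integral_prod_mul (fun y => b y * w y) (fun y => a y * w y),
    integral_prod_mul w (fun y => a y * (b y * w y))] at h0
  linarith

/-- Weighted means increase with the weight ratio and with the function. -/
theorem AbsMono.mean_le {μ : Measure ℝ} {g g' w w' : ℝ → ℝ} [SFinite μ]
    (hg : AbsMono g) (hgg : ∀ y, g y ≤ g' y) (hw : ∀ y, 0 < w y) (hw' : ∀ y, 0 ≤ w' y)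
    (hr : AbsMono fun y => w' y / w y) (i1 : Integrable w μ) (i2 : Integrable w' μ)
    (i3 : Integrable (fun y => g y * w y) μ) (i4 : Integrable (fun y => g y * w' y) μ)
    (i5 : Integrable (fun y => g' y * w' y) μ)
    (p1 : 0 < ∫ y, w y ∂μ) (p2 : 0 < ∫ y, w' y ∂μ) :
    (∫ y, g y * w y ∂μ) / ∫ y, w y ∂μ ≤ (∫ y, g' y * w' y ∂μ) / ∫ y, w' y ∂μ := by
  have e : ∀ y, w' y / w y * w y = w' y := fun y => div_mul_cancel₀ _ (hw y).ne'
  -- Association of g with the ratio w'/w under the weight w: multiplying by the ratio changes w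
  -- into w'.
  have h := AbsMono.chebyshev (μ := μ) hg hr (fun y => (hw y).le) i1 i3 (by simpa only [e] using i2)
    (by simpa only [e] using i4)
  simp only [e] at h
  rw [div_le_div_iff₀ p1 p2]
  refine h.trans (mul_le_mul_of_nonneg_right ?_ p1.le)
  exact integral_mono i4 i5 fun y => mul_le_mul_of_nonneg_right (hgg y) (hw' y)

/-! ### Gaussian shifts -/

theorem integrable_neg_gaussian {v : ℝ≥0} {G : ℝ → ℝ} (h : Integrable G (gaussianReal 0 v)) :
    Integrable (fun y => G (-y)) (gaussianReal 0 v) := by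
  have e : (gaussianReal 0 v).map (fun y => -y) = gaussianReal 0 v := by
    simp [gaussianReal_map_neg]
  have mp : MeasurePreserving (fun y : ℝ => -y) (gaussianReal 0 v) (gaussianReal 0 v) :=
    ⟨measurable_neg, e⟩
  exact mp.integrable_comp_of_integrable h

theorem integral_neg_gaussian (v : ℝ≥0) (G : ℝ → ℝ) :
    ∫ y, G (-y) ∂(gaussianReal 0 v) = ∫ y, G y ∂(gaussianReal 0 v) := by
  have e : (gaussianReal 0 v).map (fun y => -y) = gaussianReal 0 v := by
    simp [gaussianReal_map_neg]
  conv_rhs => rw [← e]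
  exact ((MeasurableEquiv.neg ℝ).measurableEmbedding.integral_map G).symm

/-- Completing the square: a shift is an exponential tilt up to a factor free of y, so different
shifts can be compared under one centred law. -/
theorem gaussianPDFReal_shift {v : ℝ≥0} (hv : v ≠ 0) (x y : ℝ) :
    gaussianPDFReal x v y
      = Real.exp (-(x ^ 2 / (2 * v))) * (gaussianPDFReal 0 v y * Real.exp (x / v * y)) := by
  have hv' : (v : ℝ) ≠ 0 := by exact_mod_cast hv
  simp only [gaussianPDFReal]
  have : ∀ a b c r : ℝ, Real.exp a * (r * Real.exp b * Real.exp c) = r * Real.exp (a + b + c) := by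
    intro a b c r
    rw [Real.exp_add, Real.exp_add]; ring
  rw [this]
  congr 2
  field_simp
  ring

theorem integral_shift {v : ℝ≥0} (hv : v ≠ 0) (G : ℝ → ℝ) (x : ℝ) :
    ∫ z, G (x + z) ∂(gaussianReal 0 v)
      = Real.exp (-(x ^ 2 / (2 * v))) * ∫ y, G y * Real.exp (x / v * y) ∂(gaussianReal 0 v) := by
  have h1 : ∫ z, G (x + z) ∂(gaussianReal 0 v) = ∫ y, G y ∂(gaussianReal x v) := by
    have := gaussianReal_map_const_add (μ := 0) (v := v) x
    rw [zero_add] at this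
    rw [← this]
    exact ((MeasurableEquiv.addLeft x).measurableEmbedding.integral_map G).symm
  rw [h1, integral_gaussianReal_eq_integral_smul hv, integral_gaussianReal_eq_integral_smul hv,
    ← integral_const_mul]
  congr 1
  funext y
  rw [gaussianPDFReal_shift hv]
  simp only [smul_eq_mul]
  ring

theorem integrable_gaussian_iff {v : ℝ≥0} (hv : v ≠ 0) (G : ℝ → ℝ) (x : ℝ) :
    Integrable G (gaussianReal x v) ↔ Integrable fun y => gaussianPDFReal x v y * G y := by
  rw [gaussianReal_of_var_ne_zero _ hv, integrable_withDensity_iff_integrable_smul'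
    (measurable_gaussianPDF _ _) (ae_of_all _ fun _ => gaussianPDF_lt_top)]
  simp only [toReal_gaussianPDF, smul_eq_mul]

theorem integrable_shift_iff {v : ℝ≥0} (hv : v ≠ 0) (G : ℝ → ℝ) (x : ℝ) :
    Integrable (fun z => G (x + z)) (gaussianReal 0 v) ↔
      Integrable (fun y => G y * Real.exp (x / v * y)) (gaussianReal 0 v) := by
  have h1 : Integrable (fun z => G (x + z)) (gaussianReal 0 v) ↔
      Integrable G (gaussianReal x v) := by
    have := gaussianReal_map_const_add (μ := 0) (v := v) x
    rw [zero_add] at this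
    rw [← this]
    exact ((MeasurableEquiv.addLeft x).measurableEmbedding.integrable_map_iff).symm
  rw [h1, integrable_gaussian_iff hv, integrable_gaussian_iff hv]
  have e : (fun y => gaussianPDFReal x v y * G y) = fun y => Real.exp (-(x ^ 2 / (2 * v))) *
      (gaussianPDFReal 0 v y * (G y * Real.exp (x / v * y))) := by
    funext y
    rw [gaussianPDFReal_shift hv]
    ring
  rw [e, integrable_const_mul_iff (Real.exp_pos _).ne'.isUnit]

/-- The centred law is symmetric, so exp(xy/v) may be averaged over y and -y. The prefactor depends
on x only and cancels in tilted means. -/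
theorem fold_even {v : ℝ≥0} (hv : v ≠ 0) {G : ℝ → ℝ} (he : ∀ y, G (-y) = G y) {x : ℝ}
    (hi : Integrable (fun z => G (x + z)) (gaussianReal 0 v)) :
    Integrable (fun y => G y * Real.cosh (x / v * y)) (gaussianReal 0 v) ∧
    ∫ z, G (x + z) ∂(gaussianReal 0 v) = Real.exp (-(x ^ 2 / (2 * v))) *
      ∫ y, G y * Real.cosh (x / v * y) ∂(gaussianReal 0 v) := by
  have h1 := (integrable_shift_iff hv G x).1 hi
  have h2 := integrable_neg_gaussian h1
  have h3 := integral_neg_gaussian v fun y => G y * Real.exp (x / v * y)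
  have e : (fun y => G y * Real.cosh (x / v * y)) = fun y =>
      (1 / 2) * (G y * Real.exp (x / v * y) + G (-y) * Real.exp (x / v * -y)) := by
    funext y
    rw [Real.cosh_eq, he, mul_neg]
    ring
  rw [e]
  refine ⟨(h1.add h2).const_mul _, ?_⟩
  rw [integral_shift hv, integral_const_mul, integral_add h1 h2, h3]
  ring

theorem fold_odd {v : ℝ≥0} (hv : v ≠ 0) {G : ℝ → ℝ} (he : ∀ y, G (-y) = -G y) {x : ℝ}
    (hi : Integrable (fun z => G (x + z)) (gaussianReal 0 v)) :
    Integrable (fun y => G y * Real.sinh (x / v * y)) (gaussianReal 0 v) ∧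
    ∫ z, G (x + z) ∂(gaussianReal 0 v) = Real.exp (-(x ^ 2 / (2 * v))) *
      ∫ y, G y * Real.sinh (x / v * y) ∂(gaussianReal 0 v) := by
  have h1 := (integrable_shift_iff hv G x).1 hi
  have h2 := integrable_neg_gaussian h1
  have h3 := integral_neg_gaussian v fun y => G y * Real.exp (x / v * y)
  have e : (fun y => G y * Real.sinh (x / v * y)) = fun y =>
      (1 / 2) * (G y * Real.exp (x / v * y) + G (-y) * Real.exp (x / v * -y)) := by
    funext y
    rw [Real.sinh_eq, he, mul_neg]
    ring
  rw [e]
  refine ⟨(h1.add h2).const_mul _, ?_⟩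
  rw [integral_shift hv, integral_const_mul, integral_add h1 h2, h3]
  ring

/-! ### Tilted expectations -/

/-- The expectation of `g(x + z)` under the Gaussian law of `z` tilted by `exp (m f(x + z))`. -/
def tilt (m : ℝ) (v : ℝ≥0) (f g : ℝ → ℝ) (x : ℝ) : ℝ :=
  (∫ z, g (x + z) * Real.exp (m * f (x + z)) ∂(gaussianReal 0 v)) /
    ∫ z, Real.exp (m * f (x + z)) ∂(gaussianReal 0 v)

theorem integral_exp_gaussian_pos {v : ℝ≥0} {F : ℝ → ℝ}
    (hi : Integrable (fun z => Real.exp (F z)) (gaussianReal 0 v)) :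
    0 < ∫ z, Real.exp (F z) ∂(gaussianReal 0 v) := integral_exp_pos hi

theorem tilt_even {m : ℝ} {v : ℝ≥0} {f g : ℝ → ℝ} (hf : ∀ x, f (-x) = f x)
    (hg : ∀ x, g (-x) = g x) (x : ℝ) : tilt m v f g (-x) = tilt m v f g x := by
  unfold tilt
  have e : ∀ z : ℝ, -x + z = -(x + -z) := fun z => by ring
  simp only [e, hf, hg]
  rw [integral_neg_gaussian v fun z => g (x + z) * Real.exp (m * f (x + z)),
    integral_neg_gaussian v fun z => Real.exp (m * f (x + z))]

theorem tilt_odd {m : ℝ} {v : ℝ≥0} {f g : ℝ → ℝ} (hf : ∀ x, f (-x) = f x)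
    (hg : ∀ x, g (-x) = -g x) (x : ℝ) : tilt m v f g (-x) = -tilt m v f g x := by
  unfold tilt
  have e : ∀ z : ℝ, -x + z = -(x + -z) := fun z => by ring
  simp only [e, hf, hg, neg_mul, integral_neg, neg_div]
  rw [integral_neg_gaussian v fun z => g (x + z) * Real.exp (m * f (x + z)),
    integral_neg_gaussian v fun z => Real.exp (m * f (x + z))]

/-- Folding divides by v, while the variance vanishes when ξ' takes equal values at consecutive q's;
that case is treated apart. -/
theorem tilt_zero_var (m : ℝ) (f g : ℝ → ℝ) (x : ℝ) : tilt m 0 f g x = g x := by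
  unfold tilt
  simp [gaussianReal_zero_var, (Real.exp_pos _).ne']

theorem absMono_weight_ratio {v : ℝ≥0} {m m' : ℝ} {f f' : ℝ → ℝ}
    (hr : AbsMono fun y => m' * f' y - m * f y) {x x' : ℝ} (hx : 0 ≤ x) (hxx : x ≤ x') :
    AbsMono fun y => (Real.exp (m' * f' y) * Real.cosh (x' / v * y)) /
      (Real.exp (m * f y) * Real.cosh (x / v * y)) := by
  have h1 := absMono_cosh_div (s := x / v) (t := x' / v) (div_nonneg hx v.2)
    (div_le_div_of_nonneg_right hxx v.2)
  have h2 := hr.exp.mul h1 (fun _ => (Real.exp_pos _).le)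
    fun _ => (div_pos (Real.cosh_pos _) (Real.cosh_pos _)).le
  simpa only [Real.exp_sub, div_mul_div_comm] using h2

/-- After folding, this is `AbsMono.mean_le`. The point and the data vary together, so one statement
serves both for monotonicity in x and for comparing two recursions. -/
theorem tilt_le_of_even {m m' : ℝ} {v : ℝ≥0} {f f' g g' : ℝ → ℝ} {x x' : ℝ}
    (hf : ∀ x, f (-x) = f x) (hf' : ∀ x, f' (-x) = f' x) (hge : ∀ x, g' (-x) = g' x)
    (hr : AbsMono fun y => m' * f' y - m * f y) (hg : AbsMono g) (hgg : ∀ y, g y ≤ g' y)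
    (hx : 0 ≤ x) (hxx : x ≤ x')
    (i1 : Integrable (fun z => Real.exp (m * f (x + z))) (gaussianReal 0 v))
    (i2 : Integrable (fun z => Real.exp (m' * f' (x' + z))) (gaussianReal 0 v))
    (i3 : Integrable (fun z => g (x + z) * Real.exp (m * f (x + z))) (gaussianReal 0 v))
    (i4 : Integrable (fun z => g (x' + z) * Real.exp (m' * f' (x' + z))) (gaussianReal 0 v))
    (i5 : Integrable (fun z => g' (x' + z) * Real.exp (m' * f' (x' + z))) (gaussianReal 0 v)) :
    tilt m v f g x ≤ tilt m' v f' g' x' := by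
  rcases eq_or_ne v 0 with rfl | hv
  · rw [tilt_zero_var, tilt_zero_var]
    exact (hg _ _ (by rwa [abs_of_nonneg hx, abs_of_nonneg (hx.trans hxx)])).trans (hgg _)
  have p1 := integral_exp_gaussian_pos i1
  have p2 := integral_exp_gaussian_pos i2
  obtain ⟨a1, b1⟩ := fold_even (G := fun y => Real.exp (m * f y)) hv (fun y => by simp [hf]) i1
  obtain ⟨a2, b2⟩ := fold_even (G := fun y => Real.exp (m' * f' y)) hv (fun y => by simp [hf']) i2
  obtain ⟨a3, b3⟩ := fold_even (G := fun y => g y * Real.exp (m * f y)) hv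
    (fun y => by simp [hf, hg.even]) i3
  obtain ⟨a4, b4⟩ := fold_even (G := fun y => g y * Real.exp (m' * f' y)) hv
    (fun y => by simp [hf', hg.even]) i4
  obtain ⟨a5, b5⟩ := fold_even (G := fun y => g' y * Real.exp (m' * f' y)) hv
    (fun y => by simp [hf', hge]) i5
  unfold tilt
  rw [b1] at p1
  rw [b2] at p2
  rw [b1, b2, b3, b5, mul_div_mul_left _ _ (Real.exp_pos _).ne',
    mul_div_mul_left _ _ (Real.exp_pos _).ne']
  simp only [mul_assoc] at a3 a4 a5 ⊢
  exact AbsMono.mean_le hg hgg (fun y => mul_pos (Real.exp_pos _) (Real.cosh_pos _))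
    (fun y => (mul_pos (Real.exp_pos _) (Real.cosh_pos _)).le)
    (absMono_weight_ratio hr hx hxx) a1 a2 a3 a4 a5 (pos_of_mul_pos_right p1 (Real.exp_pos _).le)
    (pos_of_mul_pos_right p2 (Real.exp_pos _).le)

theorem absMono_odd_mul_tanh {d : ℝ → ℝ} (ho : ∀ x, d (-x) = -d x) (hm : Monotone d) {c : ℝ}
    (hc : 0 ≤ c) : AbsMono fun y => d y * Real.tanh (c * y) := by
  have hd := odd_zero ho
  refine AbsMono.of_even (fun x => by simp [ho, Real.tanh_neg]) fun x y hx hxy => ?_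
  refine mul_le_mul (hm hxy) (tanh_monotone (mul_le_mul_of_nonneg_left hxy hc)) ?_
    (hd ▸ hm (hx.trans hxy))
  rw [← Real.tanh_zero]
  exact tanh_monotone (mul_nonneg hc hx)

theorem odd_mul_tanh_le {d d' : ℝ → ℝ} (ho : ∀ x, d (-x) = -d x) (ho' : ∀ x, d' (-x) = -d' x)
    (hm : Monotone d) (hdd : ∀ y, 0 ≤ y → d y ≤ d' y) {c c' : ℝ}
    (hc : 0 ≤ c) (hcc : c ≤ c') (y : ℝ) :
    d y * Real.tanh (c * y) ≤ d' y * Real.tanh (c' * y) := by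
  have key : ∀ y, 0 ≤ y → d y * Real.tanh (c * y) ≤ d' y * Real.tanh (c' * y) := by
    intro y hy
    have h0 : 0 ≤ d y := odd_zero ho ▸ hm hy
    refine mul_le_mul (hdd y hy) (tanh_monotone (mul_le_mul_of_nonneg_right hcc hy)) ?_
      (h0.trans (hdd y hy))
    rw [← Real.tanh_zero]
    exact tanh_monotone (mul_nonneg hc hy)
  rcases le_total 0 y with hy | hy
  · exact key y hy
  · have := key (-y) (neg_nonneg.2 hy)
    simpa [ho, ho', Real.tanh_neg] using this

/-- Odd folding produces sinh, which is tanh times the cosh weight of the even case. The tanh joins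
the integrand: d(y) tanh(cy) is even, nondecreasing in |y|, and grows with c and with d. -/
theorem tilt_le_of_odd {m m' : ℝ} {v : ℝ≥0} {f f' d d' : ℝ → ℝ} {x x' : ℝ}
    (hf : ∀ x, f (-x) = f x) (hf' : ∀ x, f' (-x) = f' x)
    (ho : ∀ x, d (-x) = -d x) (ho' : ∀ x, d' (-x) = -d' x)
    (hr : AbsMono fun y => m' * f' y - m * f y) (hm : Monotone d)
    (hdd : ∀ y, 0 ≤ y → d y ≤ d' y)
    (hx : 0 ≤ x) (hxx : x ≤ x')
    (i1 : Integrable (fun z => Real.exp (m * f (x + z))) (gaussianReal 0 v))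
    (i2 : Integrable (fun z => Real.exp (m' * f' (x' + z))) (gaussianReal 0 v))
    (i3 : Integrable (fun z => d (x + z) * Real.exp (m * f (x + z))) (gaussianReal 0 v))
    (i4 : Integrable (fun z => d (x' + z) * Real.exp (m' * f' (x' + z))) (gaussianReal 0 v))
    (i5 : Integrable (fun z => d' (x' + z) * Real.exp (m' * f' (x' + z))) (gaussianReal 0 v)) :
    tilt m v f d x ≤ tilt m' v f' d' x' := by
  rcases eq_or_ne v 0 with rfl | hv
  · rw [tilt_zero_var, tilt_zero_var]
    exact (hm hxx).trans (hdd _ (hx.trans hxx))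
  have p1 := integral_exp_gaussian_pos i1
  have p2 := integral_exp_gaussian_pos i2
  obtain ⟨a1, b1⟩ := fold_even (G := fun y => Real.exp (m * f y)) hv (fun y => by simp [hf]) i1
  obtain ⟨a2, b2⟩ := fold_even (G := fun y => Real.exp (m' * f' y)) hv (fun y => by simp [hf']) i2
  obtain ⟨a3, b3⟩ := fold_odd (G := fun y => d y * Real.exp (m * f y)) hv
    (fun y => by simp [hf, ho]) i3
  obtain ⟨a4, -⟩ := fold_odd (G := fun y => d y * Real.exp (m' * f' y)) hv
    (fun y => by simp [hf', ho]) i4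
  obtain ⟨a5, b5⟩ := fold_odd (G := fun y => d' y * Real.exp (m' * f' y)) hv
    (fun y => by simp [hf', ho']) i5
  have hc : 0 ≤ x / v := div_nonneg hx v.2
  have hcc : x / v ≤ x' / v := div_le_div_of_nonneg_right hxx v.2
  have conv : ∀ (D E : ℝ → ℝ) (c y : ℝ), D y * E y * Real.sinh (c * y)
      = D y * Real.tanh (c * y) * (E y * Real.cosh (c * y)) := fun D E c y => by
    rw [Real.tanh_eq_sinh_div_cosh]
    field_simp [(Real.cosh_pos (c * y)).ne']
  -- The mixed term of the comparison has tanh at x but cosh at x'; it is dominated by the same term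
  -- with tanh at x', which is `a4`.
  have a4' : Integrable (fun y => d y * Real.tanh (x / v * y) *
      (Real.exp (m' * f' y) * Real.cosh (x' / v * y))) (gaussianReal 0 v) := by
    refine a4.mono' ?_ (ae_of_all _ fun y => ?_)
    · have q1 := hm.measurable
      have q2 : Measurable fun y => Real.tanh (x / v * y) := by
        simp only [Real.tanh_eq_sinh_div_cosh]
        fun_prop
      exact ((q1.mul q2).aestronglyMeasurable).mul a2.aestronglyMeasurable
    · have e0 := (absMono_odd_mul_tanh ho hm hc) 0 y (by simp)
      simp only [mul_zero, Real.tanh_zero] at e0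
      rw [conv d (fun y => Real.exp (m' * f' y)), Real.norm_eq_abs, abs_of_nonneg
        (mul_nonneg e0 (mul_pos (Real.exp_pos _) (Real.cosh_pos _)).le)]
      refine mul_le_mul_of_nonneg_right ?_ (mul_pos (Real.exp_pos _) (Real.cosh_pos _)).le
      exact odd_mul_tanh_le ho ho hm (fun _ _ => le_rfl) hc hcc y
  unfold tilt
  rw [b1] at p1
  rw [b2] at p2
  rw [b1, b2, b3, b5, mul_div_mul_left _ _ (Real.exp_pos _).ne',
    mul_div_mul_left _ _ (Real.exp_pos _).ne']
  simp only [conv d (fun y => Real.exp (m * f y)), conv d' (fun y => Real.exp (m' * f' y))]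
    at a3 a5 ⊢
  exact AbsMono.mean_le (absMono_odd_mul_tanh ho hm hc) (odd_mul_tanh_le ho ho' hm hdd hc hcc)
    (fun y => mul_pos (Real.exp_pos _) (Real.cosh_pos _))
    (fun y => (mul_pos (Real.exp_pos _) (Real.cosh_pos _)).le)
    (absMono_weight_ratio hr hx hxx) a1 a2 a3 a4' a5 (pos_of_mul_pos_right p1 (Real.exp_pos _).le)
    (pos_of_mul_pos_right p2 (Real.exp_pos _).le)

section Growth

/-! ### Convex even functions of exponential Gaussian growth -/

/-- `f` is even, nonnegative and convex with derivative `d`, and `exp (M f)` is integrable for all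
Gaussian laws of variance `V`. -/
structure HasGrowth (M : ℝ) (V : ℝ≥0) (f d : ℝ → ℝ) : Prop where
  hasDeriv : ∀ x, HasDerivAt f (d x) x
  odd : ∀ x, d (-x) = -d x
  mono : Monotone d
  even : ∀ x, f (-x) = f x
  nonneg : ∀ x, 0 ≤ f x
  growth : ∀ x, Integrable (fun z => Real.exp (M * f (x + z))) (gaussianReal 0 V)

/-- `g ≥ 0` is nondecreasing in the absolute value, and `g exp (M f)` is integrable for all
Gaussian laws of variance `V`. -/
structure Admits (M : ℝ) (V : ℝ≥0) (f g : ℝ → ℝ) : Prop where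
  absMono : AbsMono g
  nonneg : ∀ x, 0 ≤ g x
  integrable : ∀ x, Integrable (fun z => g (x + z) * Real.exp (M * f (x + z))) (gaussianReal 0 V)

variable {M : ℝ} {V v : ℝ≥0} {f d g : ℝ → ℝ} {m : ℝ}

theorem HasGrowth.deriv_nonneg (hf : HasGrowth M V f d) {x : ℝ} (hx : 0 ≤ x) : 0 ≤ d x :=
  odd_zero hf.odd ▸ hf.mono hx

theorem HasGrowth.continuous (hf : HasGrowth M V f d) : Continuous f :=
  continuous_iff_continuousAt.2 fun x => (hf.hasDeriv x).continuousAt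

theorem HasGrowth.absMono (hf : HasGrowth M V f d) : AbsMono f := by
  have h : MonotoneOn f (Set.Ici 0) := by
    refine monotoneOn_of_deriv_nonneg (convex_Ici 0) hf.continuous.continuousOn
      (fun x _ => (hf.hasDeriv x).differentiableAt.differentiableWithinAt) fun x hx => ?_
    rw [interior_Ici] at hx
    rw [(hf.hasDeriv x).deriv]
    exact hf.deriv_nonneg (le_of_lt hx)
  exact AbsMono.of_even hf.even fun x y hx hxy => h hx (hx.trans hxy) hxy

/-- By the mean value theorem the increment over [|y|, |y| + 1] is a slope at a point beyond |y|.
Thus growth of f alone controls d. -/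
theorem HasGrowth.abs_deriv_le (hf : HasGrowth M V f d) (y : ℝ) :
    |d y| ≤ f (|y| + 1) - f |y| := by
  obtain ⟨c, hc, hc'⟩ := exists_hasDerivAt_eq_slope f d (lt_add_one |y|) hf.continuous.continuousOn
    fun x _ => hf.hasDeriv x
  rw [add_sub_cancel_left, div_one] at hc'
  rw [← hc', ← (absMono_of_odd hf.odd hf.mono).apply_abs y, abs_of_nonneg
    (hf.deriv_nonneg (abs_nonneg y))]
  exact hf.mono hc.1.le

/-- With t = M(f(|y| + 1) - f(|y|)), the bound M|d| ≤ t ≤ exp t is absorbed by moving the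
exponential from |y| to |y| + 1. For d² the same is done with t²/2 ≤ exp t. -/
theorem HasGrowth.abs_deriv_mul_exp_le (hf : HasGrowth M V f d) (hM : 0 < M) (y : ℝ) :
    |d y| * Real.exp (M * f y) ≤ 1 / M * Real.exp (M * f (|y| + 1)) := by
  have h1 := hf.abs_deriv_le y
  have h2 := Real.add_one_le_exp (M * (f (|y| + 1) - f |y|))
  have h3 : Real.exp (M * f (|y| + 1)) =
      Real.exp (M * (f (|y| + 1) - f |y|)) * Real.exp (M * f y) := by
    rw [← Real.exp_add, hf.absMono.apply_abs]; congr 1; ring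
  rw [h3, ← mul_assoc]
  refine mul_le_mul_of_nonneg_right ?_ (Real.exp_pos _).le
  rw [one_div, inv_mul_eq_div, le_div_iff₀ hM]
  nlinarith

theorem HasGrowth.sq_deriv_mul_exp_le (hf : HasGrowth M V f d) (hM : 0 < M) (y : ℝ) :
    d y ^ 2 * Real.exp (M * f y) ≤ 2 / M ^ 2 * Real.exp (M * f (|y| + 1)) := by
  have h1 := hf.abs_deriv_le y
  have h0 := abs_nonneg (d y)
  have h2 := Real.quadratic_le_exp_of_nonneg (x := M * (f (|y| + 1) - f |y|))
    (mul_nonneg hM.le (h0.trans h1))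
  have h3 : Real.exp (M * f (|y| + 1)) =
      Real.exp (M * (f (|y| + 1) - f |y|)) * Real.exp (M * f y) := by
    rw [← Real.exp_add, hf.absMono.apply_abs]; congr 1; ring
  rw [h3, ← mul_assoc]
  refine mul_le_mul_of_nonneg_right ?_ (Real.exp_pos _).le
  rw [div_mul_eq_mul_div, le_div_iff₀ (by positivity)]
  have h4 : M * |d y| ≤ M * (f (|y| + 1) - f |y|) := mul_le_mul_of_nonneg_left h1 hM.le
  have h5 : (M * |d y|) ^ 2 ≤ (M * (f (|y| + 1) - f |y|)) ^ 2 :=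
    pow_le_pow_left₀ (mul_nonneg hM.le h0) h4 2
  rw [mul_pow, sq_abs] at h5
  have h6 : 0 ≤ M * (f (|y| + 1) - f |y|) := mul_nonneg hM.le (h0.trans h1)
  linarith

/-! ### Integrability under translates and smaller variances -/

theorem AbsMono.integrable_abs_add {G : ℝ → ℝ} {μ : Measure ℝ} (hG : AbsMono G)
    (h0 : ∀ x, 0 ≤ G x) (hi : ∀ x, Integrable (fun z => G (x + z)) μ) (x R : ℝ) :
    Integrable (fun z => G (|x + z| + R)) μ := by
  have hm := hG.measurable
  refine ((hi (x + R)).add (hi (x - R))).mono' (Measurable.aestronglyMeasurable (by fun_prop))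
    (ae_of_all _ fun z => ?_)
  rw [Real.norm_eq_abs, abs_of_nonneg (h0 _), Pi.add_apply]
  rcases abs_cases (x + z) with ⟨h, -⟩ | ⟨h, -⟩
  · rw [h, show x + z + R = x + R + z by ring]
    exact le_add_of_nonneg_right (h0 _)
  · rw [h, show -(x + z) + R = -(x - R + z) by ring, hG.even]
    exact le_add_of_nonneg_left (h0 _)

theorem integrable_prod_of_gaussian_add {G : ℝ → ℝ} (hG : Measurable G) {x : ℝ}
    (hi : Integrable (fun z => G (x + z)) (gaussianReal 0 (V + v))) :
    Integrable (fun p : ℝ × ℝ => G (x + p.1 + p.2))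
      ((gaussianReal 0 V).prod (gaussianReal 0 v)) := by
  have e := gaussianReal_conv_gaussianReal (m₁ := 0) (m₂ := 0) (v₁ := V) (v₂ := v)
  rw [add_zero, Measure.conv] at e
  rw [← e] at hi
  have := (integrable_map_measure (Measurable.aestronglyMeasurable (by fun_prop))
    (by fun_prop)).1 hi
  simpa only [Function.comp_def, ← add_assoc] using this

/-- Fubini gives integrability only for almost every shift u, but one u works for all integer base
points. The shifts ⌊x - u⌋ + u and ⌈x - u⌉ + u bracket x, and for each z one of them moves z at
least as far from 0 as x does. -/
theorem AbsMono.integrable_of_gaussian_add {G : ℝ → ℝ} (hG : AbsMono G) (h0 : ∀ x, 0 ≤ G x)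
    (hi : ∀ x, Integrable (fun z => G (x + z)) (gaussianReal 0 (V + v))) (x : ℝ) :
    Integrable (fun z => G (x + z)) (gaussianReal 0 v) := by
  have hm := hG.measurable
  have h1 : ∀ᵐ u ∂(gaussianReal 0 V), ∀ n : ℤ,
      Integrable (fun z => G (n + u + z)) (gaussianReal 0 v) :=
    ae_all_iff.2 fun n => (integrable_prod_of_gaussian_add hm (hi n)).prod_right_ae
  obtain ⟨u, hu⟩ := h1.exists
  refine ((hu ⌊x - u⌋).add (hu ⌈x - u⌉)).mono' (Measurable.aestronglyMeasurable (by fun_prop))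
    (ae_of_all _ fun z => ?_)
  have ha := Int.floor_le (x - u)
  have hb := Int.le_ceil (x - u)
  rw [Real.norm_eq_abs, abs_of_nonneg (h0 _), Pi.add_apply]
  rcases le_total 0 (x + z) with h | h
  · refine (hG _ _ ?_).trans (le_add_of_nonneg_left (h0 _))
    rw [abs_of_nonneg h, abs_of_nonneg] <;> linarith
  · refine (hG _ _ ?_).trans (le_add_of_nonneg_right (h0 _))
    rw [abs_of_nonpos h, abs_of_nonpos] <;> linarith

theorem HasGrowth.absMono_exp (hf : HasGrowth M V f d) (hM : 0 ≤ M) :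
    AbsMono fun y => Real.exp (M * f y) := (hf.absMono.const_mul hM).exp

theorem HasGrowth.admits_one (hf : HasGrowth M V f d) : Admits M V f fun _ => 1 :=
  ⟨fun _ _ _ => le_rfl, fun _ => zero_le_one, by simpa only [one_mul] using hf.growth⟩

theorem HasGrowth.admits_abs_deriv (hf : HasGrowth M V f d) (hM : 0 < M) :
    Admits M V f fun y => |d y| := by
  refine ⟨absMono_of_odd hf.odd hf.mono, fun _ => abs_nonneg _, fun x => ?_⟩
  have hd : Measurable fun z => |d (x + z)| :=
    measurable_abs.comp (hf.mono.measurable.comp (measurable_const_add x))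
  have hc := hf.continuous
  refine (((hf.absMono_exp hM.le).integrable_abs_add (fun _ => (Real.exp_pos _).le)
    hf.growth x 1).const_mul (1 / M)).mono' (hd.mul (by fun_prop)).aestronglyMeasurable
    (ae_of_all _ fun z => ?_)
  rw [Real.norm_eq_abs, abs_of_nonneg (mul_nonneg (abs_nonneg _) (Real.exp_pos _).le)]
  exact hf.abs_deriv_mul_exp_le hM _

theorem HasGrowth.admits_sq_deriv (hf : HasGrowth M V f d) (hM : 0 < M) :
    Admits M V f fun y => d y ^ 2 := by
  refine ⟨fun x y hxy => sq_le_sq.2 (absMono_of_odd hf.odd hf.mono x y hxy),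
    fun _ => sq_nonneg _, fun x => ?_⟩
  have hd := hf.mono.measurable
  have hc := hf.continuous
  refine (((hf.absMono_exp hM.le).integrable_abs_add (fun _ => (Real.exp_pos _).le)
    hf.growth x 1).const_mul (2 / M ^ 2)).mono' (Measurable.aestronglyMeasurable (by fun_prop))
    (ae_of_all _ fun z => ?_)
  rw [Real.norm_eq_abs, abs_of_nonneg (mul_nonneg (sq_nonneg _) (Real.exp_pos _).le)]
  exact hf.sq_deriv_mul_exp_le hM _

theorem HasGrowth.admits_mul_exp (hf : HasGrowth M V f d) (hM : 0 ≤ M) (hg : Admits M V f g) :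
    AbsMono fun y => g y * Real.exp (M * f y) :=
  hg.absMono.mul (hf.absMono_exp hM) hg.nonneg fun _ => (Real.exp_pos _).le

theorem HasGrowth.integrable_mul_exp_top (hf : HasGrowth M (V + v) f d) (hM : 0 ≤ M)
    (hg : Admits M (V + v) f g) (x : ℝ) :
    Integrable (fun z => g (x + z) * Real.exp (M * f (x + z))) (gaussianReal 0 v) :=
  (hf.admits_mul_exp hM hg).integrable_of_gaussian_add
    (fun _ => mul_nonneg (hg.nonneg _) (Real.exp_pos _).le) hg.integrable x

theorem HasGrowth.integrable_of_abs_le (hf : HasGrowth M (V + v) f d)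
    (hm0 : 0 ≤ m) (hm : m ≤ M) (hg : Admits M (V + v) f g) {a : ℝ → ℝ} (ha : Measurable a)
    (hag : ∀ y, |a y| ≤ g y) (x : ℝ) :
    Integrable (fun z => a (x + z) * Real.exp (m * f (x + z))) (gaussianReal 0 v) := by
  have hc := hf.continuous
  refine (hf.integrable_mul_exp_top (hm0.trans hm) hg x).mono'
    (Measurable.aestronglyMeasurable (by fun_prop))
    (ae_of_all _ fun z => ?_)
  rw [Real.norm_eq_abs, abs_mul, Real.abs_exp]
  exact mul_le_mul (hag _) (Real.exp_le_exp.2 (mul_le_mul_of_nonneg_right hm (hf.nonneg _)))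
    (Real.exp_pos _).le (hg.nonneg _)

theorem HasGrowth.integrable_mul_exp (hf : HasGrowth M (V + v) f d)
    (hm0 : 0 ≤ m) (hm : m ≤ M) (hg : Admits M (V + v) f g) (x : ℝ) :
    Integrable (fun z => g (x + z) * Real.exp (m * f (x + z))) (gaussianReal 0 v) :=
  hf.integrable_of_abs_le hm0 hm hg hg.absMono.measurable
    (fun y => (abs_of_nonneg (hg.nonneg y)).le) x

theorem HasGrowth.integrable_exp (hf : HasGrowth M (V + v) f d)
    (hm0 : 0 ≤ m) (hm : m ≤ M) (x : ℝ) :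
    Integrable (fun z => Real.exp (m * f (x + z))) (gaussianReal 0 v) := by
  simpa only [one_mul] using hf.integrable_mul_exp hm0 hm hf.admits_one x

theorem HasGrowth.integrable_deriv_mul_exp (hf : HasGrowth M (V + v) f d) (hM : 0 < M)
    (hm0 : 0 ≤ m) (hm : m ≤ M) (x : ℝ) :
    Integrable (fun z => d (x + z) * Real.exp (m * f (x + z))) (gaussianReal 0 v) :=
  hf.integrable_of_abs_le hm0 hm (hf.admits_abs_deriv hM) hf.mono.measurable (fun _ => le_rfl) x

theorem HasGrowth.integrable_self (hf : HasGrowth M (V + v) f d) (hM : 0 < M) (x : ℝ) :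
    Integrable (fun z => f (x + z)) (gaussianReal 0 v) := by
  have hc := hf.continuous
  refine ((hf.integrable_exp hM.le le_rfl x).const_mul (1 / M)).mono'
    (Measurable.aestronglyMeasurable (by fun_prop))
    (ae_of_all _ fun z => ?_)
  rw [Real.norm_eq_abs, abs_of_nonneg (hf.nonneg _), one_div, inv_mul_eq_div, le_div_iff₀ hM]
  have := Real.add_one_le_exp (M * f (x + z))
  linarith

/-! ### One step of the recursion -/

/-- At m = 0 both sides are 1, which spares the density formulas a case distinction. -/
theorem exp_mul_step {x : ℝ}
    (hi : Integrable (fun z => Real.exp (m * f (x + z))) (gaussianReal 0 v)) :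
    Real.exp (m * step m v f x) = ∫ z, Real.exp (m * f (x + z)) ∂(gaussianReal 0 v) := by
  unfold step
  split_ifs with h
  · simp [h]
  · rw [← mul_assoc, mul_one_div_cancel h, one_mul, Real.exp_log (integral_exp_gaussian_pos hi)]

/-- Jensen's inequality (power means increase with the exponent), proved from supporting lines after
normalising by a: 1 + t ≤ exp t when m = 0, Bernoulli with exponent M/m ≥ 1 otherwise. The linear
bound integrates to exactly 1. -/
theorem HasGrowth.exp_mul_step_le (hf : HasGrowth M (V + v) f d) (hM : 0 < M)
    (hm0 : 0 ≤ m) (hm : m ≤ M) (x : ℝ) :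
    Real.exp (M * step m v f x) ≤ ∫ z, Real.exp (M * f (x + z)) ∂(gaussianReal 0 v) := by
  have iM := hf.integrable_exp hM.le le_rfl x
  set a := step m v f x with ha
  suffices h : 1 ≤ ∫ z, Real.exp (-(M * a)) * Real.exp (M * f (x + z)) ∂(gaussianReal 0 v) by
    rw [integral_const_mul, Real.exp_neg, inv_mul_eq_div, le_div_iff₀ (Real.exp_pos _)] at h
    linarith
  rcases hm0.eq_or_lt with h0 | h0
  · have ha' : a = ∫ z, f (x + z) ∂(gaussianReal 0 v) := by rw [ha, step, if_pos h0.symm]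
    have i1 := hf.integrable_self hM x
    calc (1 : ℝ) = ∫ z, (M * f (x + z) + (1 - M * a)) ∂(gaussianReal 0 v) := by
          rw [integral_add (i1.const_mul M) (integrable_const _), integral_const_mul, ← ha']
          simp
      _ ≤ _ := integral_mono ((i1.const_mul M).add (integrable_const _)) (iM.const_mul _)
          fun z => by
            have := Real.add_one_le_exp (-(M * a) + M * f (x + z))
            rw [Real.exp_add] at this
            simp only
            linarith
  · have i1 := hf.integrable_exp hm0 hm x
    have e := exp_mul_step i1
    rw [← ha] at e
    have hp : 1 ≤ M / m := (one_le_div h0).2 hm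
    calc (1 : ℝ) = ∫ z, (M / m * (Real.exp (-(m * a)) * Real.exp (m * f (x + z))) + (1 - M / m))
          ∂(gaussianReal 0 v) := by
          rw [integral_add ((i1.const_mul _).const_mul _) (integrable_const _), integral_const_mul,
            integral_const_mul, ← e, ← Real.exp_add]
          simp
      _ ≤ _ := integral_mono (((i1.const_mul _).const_mul _).add (integrable_const _))
          (iM.const_mul _) fun z => by
            have h1 := one_add_mul_self_le_rpow_one_add
              (s := Real.exp (-(m * a) + m * f (x + z)) - 1)
              (by linarith [Real.exp_pos (-(m * a) + m * f (x + z))]) hp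
            rw [add_sub_cancel, ← Real.exp_mul] at h1
            have h2 : (-(m * a) + m * f (x + z)) * (M / m) = -(M * a) + M * f (x + z) := by
              field_simp
            rw [h2, Real.exp_add, Real.exp_add] at h1
            simp only
            linarith

theorem HasGrowth.step_hasDeriv (hf : HasGrowth M (V + v) f d) (hM : 0 < M)
    (hm0 : 0 ≤ m) (hm : m ≤ M) (x : ℝ) :
    HasDerivAt (step m v f) (tilt m v f d x) x := by
  have hc := hf.continuous
  have hd := hf.mono.measurable
  have hG := hf.absMono_exp hM.le
  -- The 2 is one unit for the ball around x and one for the bound on the derivative.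
  have hbi := (hG.integrable_abs_add (fun _ => (Real.exp_pos _).le)
    (fun x => hf.integrable_exp hM.le le_rfl x) x 2).const_mul (1 / M)
  have hb : ∀ z, ∀ y ∈ Metric.ball x 1,
      |d (y + z)| * Real.exp (M * f (y + z)) ≤ 1 / M * Real.exp (M * f (|x + z| + 2)) := by
    intro z y hy
    refine (hf.abs_deriv_mul_exp_le hM _).trans (mul_le_mul_of_nonneg_left ?_ (by positivity))
    refine hG _ _ ?_
    rw [abs_of_nonneg (a := |y + z| + 1) (by positivity),
      abs_of_nonneg (a := |x + z| + 2) (by positivity)]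
    have h1 : |y - x| < 1 := by simpa [Real.dist_eq] using hy
    have h2 : |y + z| ≤ |y - x| + |x + z| := by
      rw [show y + z = (y - x) + (x + z) by ring]; exact abs_add_le _ _
    linarith
  have hexp : ∀ y, Real.exp (m * f y) ≤ Real.exp (M * f y) := fun y =>
    Real.exp_le_exp.2 (mul_le_mul_of_nonneg_right hm (hf.nonneg _))
  have hshift : ∀ z y : ℝ, HasDerivAt (fun y => f (y + z)) (d (y + z)) y := fun z y =>
    (hf.hasDeriv (y + z)).comp_add_const y z
  by_cases h0 : m = 0
  · have key := hasDerivAt_integral_of_dominated_loc_of_deriv_le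
      (μ := gaussianReal 0 v) (F := fun y z => f (y + z)) (F' := fun y z => d (y + z)) (x₀ := x)
      (bound := fun z => 1 / M * Real.exp (M * f (|x + z| + 2)))
      (Metric.ball_mem_nhds x one_pos) (Filter.Eventually.of_forall fun y => by fun_prop)
      (hf.integrable_self hM x) (Measurable.aestronglyMeasurable (by fun_prop))
      (ae_of_all _ fun z y hy => by
        refine le_trans ?_ (hb z y hy)
        rw [Real.norm_eq_abs]
        exact le_mul_of_one_le_right (abs_nonneg _)
          (Real.one_le_exp (mul_nonneg hM.le (hf.nonneg _)))) hbi
      (ae_of_all _ fun z y _ => hshift z y)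
    have e1 : step m v f = fun y => ∫ z, f (y + z) ∂(gaussianReal 0 v) := by
      funext y; rw [step, if_pos h0]
    have e2 : tilt m v f d x = ∫ z, d (x + z) ∂(gaussianReal 0 v) := by
      simp [tilt, h0]
    rw [e1, e2]
    exact key.2
  · have key := hasDerivAt_integral_of_dominated_loc_of_deriv_le
      (μ := gaussianReal 0 v) (F := fun y z => Real.exp (m * f (y + z)))
      (F' := fun y z => m * (d (y + z) * Real.exp (m * f (y + z)))) (x₀ := x)
      (bound := fun z => m * (1 / M * Real.exp (M * f (|x + z| + 2))))
      (Metric.ball_mem_nhds x one_pos) (Filter.Eventually.of_forall fun y => by fun_prop)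
      (hf.integrable_exp hm0 hm x) (Measurable.aestronglyMeasurable (by fun_prop))
      (ae_of_all _ fun z y hy => by
        rw [Real.norm_eq_abs, abs_mul, abs_of_nonneg hm0, abs_mul, Real.abs_exp]
        refine mul_le_mul_of_nonneg_left (le_trans ?_ (hb z y hy)) hm0
        exact mul_le_mul_of_nonneg_left (hexp _) (abs_nonneg _)) (hbi.const_mul m)
      (ae_of_all _ fun z y _ =>
        ((hshift z y).const_mul m).exp.congr_deriv (by ring))
    have e1 : step m v f = fun y => 1 / m *
        Real.log (∫ z, Real.exp (m * f (y + z)) ∂(gaussianReal 0 v)) := by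
      funext y; rw [step, if_neg h0]
    have hpos := integral_exp_gaussian_pos (hf.integrable_exp hm0 hm x)
    rw [e1]
    refine ((key.2.log hpos.ne').const_mul (1 / m)).congr_deriv ?_
    rw [integral_const_mul, tilt]
    field_simp

theorem HasGrowth.tilt_mono (hf : HasGrowth M (V + v) f d) (hm0 : 0 ≤ m) (hm : m ≤ M)
    (hg : Admits M (V + v) f g) : AbsMono (tilt m v f g) :=
  AbsMono.of_even (tilt_even hf.even hg.absMono.even) fun x y hx hxy =>
    tilt_le_of_even hf.even hf.even hg.absMono.even (by simp [AbsMono]) hg.absMono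
      (fun _ => le_rfl) hx hxy (hf.integrable_exp hm0 hm x) (hf.integrable_exp hm0 hm y)
      (hf.integrable_mul_exp hm0 hm hg x) (hf.integrable_mul_exp hm0 hm hg y)
      (hf.integrable_mul_exp hm0 hm hg y)

theorem HasGrowth.tilt_le_tilt_top (hf : HasGrowth M (V + v) f d) (hm0 : 0 ≤ m) (hm : m ≤ M)
    (hg : Admits M (V + v) f g) (x : ℝ) : tilt m v f g x ≤ tilt M v f g x := by
  have hM := hm0.trans hm
  rw [← (hf.tilt_mono hm0 hm hg).apply_abs x, ← (hf.tilt_mono hM le_rfl hg).apply_abs x]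
  refine tilt_le_of_even hf.even hf.even hg.absMono.even ?_ hg.absMono
      (fun _ => le_rfl) (abs_nonneg x) le_rfl (hf.integrable_exp hm0 hm _)
      (hf.integrable_exp hM le_rfl _)
      (hf.integrable_mul_exp hm0 hm hg _) (hf.integrable_mul_exp hM le_rfl hg _)
      (hf.integrable_mul_exp hM le_rfl hg _)
  simpa only [sub_mul] using hf.absMono.const_mul (sub_nonneg.2 hm)

/-- Raise the tilt to M and bound exp(M · step) by the Gaussian average of exp(M f). That average is
the denominator of the tilt, so it cancels; the numerator is integrable over the remaining variance
V by Fubini. -/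
theorem HasGrowth.admits_tilt (hf : HasGrowth M (V + v) f d) (hM : 0 < M) (hm0 : 0 ≤ m)
    (hm : m ≤ M) (hg : Admits M (V + v) f g) :
    Admits M V (step m v f) (tilt m v f g) := by
  have ht := hf.tilt_mono hm0 hm hg
  have hpos : ∀ x, 0 ≤ tilt m v f g x := fun x =>
    div_nonneg (integral_nonneg fun z => mul_nonneg (hg.nonneg _) (Real.exp_pos _).le)
      (integral_nonneg fun z => (Real.exp_pos _).le)
  refine ⟨ht, hpos, fun x => ?_⟩
  have hmt := ht.measurable
  have hcs : Continuous (step m v f) :=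
    continuous_iff_continuousAt.2 fun x => (hf.step_hasDeriv hM hm0 hm x).continuousAt
  have hprod := integrable_prod_of_gaussian_add (V := V) (v := v) (x := x)
    (G := fun y => g y * Real.exp (M * f y)) (hf.admits_mul_exp hM.le hg).measurable
    (hg.integrable x)
  refine hprod.integral_prod_left.mono' (Measurable.aestronglyMeasurable (by fun_prop))
    (ae_of_all _ fun u => ?_)
  rw [Real.norm_eq_abs, abs_of_nonneg (mul_nonneg (hpos _) (Real.exp_pos _).le)]
  refine (mul_le_mul (hf.tilt_le_tilt_top hm0 hm hg _) (hf.exp_mul_step_le hM hm0 hm _)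
    (Real.exp_pos _).le ((hpos _).trans (hf.tilt_le_tilt_top hm0 hm hg _))).trans_eq ?_
  exact div_mul_cancel₀ _ (integral_exp_gaussian_pos (hf.integrable_exp hM.le le_rfl (x + u))).ne'

theorem HasGrowth.step (hf : HasGrowth M (V + v) f d) (hM : 0 < M) (hm0 : 0 ≤ m) (hm : m ≤ M) :
    HasGrowth M V (step m v f) (tilt m v f d) where
  hasDeriv := hf.step_hasDeriv hM hm0 hm
  odd := tilt_odd hf.even hf.odd
  mono := monotone_of_odd_of_monotoneOn_nonneg (tilt_odd hf.even hf.odd) fun x hx y _ hxy =>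
    tilt_le_of_odd hf.even hf.even hf.odd hf.odd (by simp [AbsMono]) hf.mono (fun _ _ => le_rfl) hx
      hxy (hf.integrable_exp hm0 hm x) (hf.integrable_exp hm0 hm y)
      (hf.integrable_deriv_mul_exp hM hm0 hm x) (hf.integrable_deriv_mul_exp hM hm0 hm y)
      (hf.integrable_deriv_mul_exp hM hm0 hm y)
  even x := by
    have e : ∀ z : ℝ, -x + z = -(x + -z) := fun z => by ring
    simp only [Parisi.step, e, hf.even]
    rw [integral_neg_gaussian v fun z => f (x + z),
      integral_neg_gaussian v fun z => Real.exp (m * f (x + z))]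
  nonneg x := by
    unfold Parisi.step
    split_ifs with h
    · exact integral_nonneg fun z => hf.nonneg _
    · refine mul_nonneg (by positivity) (Real.log_nonneg ?_)
      calc (1 : ℝ) = ∫ _, 1 ∂(gaussianReal 0 v) := by simp
        _ ≤ _ := integral_mono (integrable_const _) (hf.integrable_exp hm0 hm x) fun z =>
          Real.one_le_exp (mul_nonneg hm0 (hf.nonneg _))
  growth x := by
    -- The constant 1 is its own tilted mean, so its admissibility one level lower is the growth
    -- condition.
    have h := (hf.admits_tilt hM hm0 hm hf.admits_one).integrable x
    have e : ∀ y, tilt m v f (fun _ => 1) y = 1 := fun y => by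
      simp only [tilt, one_mul]
      exact div_self (integral_exp_gaussian_pos (hf.integrable_exp hm0 hm y)).ne'
    simpa only [e, one_mul] using h

/-! ### Comparison of two recursions -/

variable {f' d' g' : ℝ → ℝ} {m' : ℝ}

/-- On the half-line m'd' ≥ md, since 0 ≤ m ≤ m' and 0 ≤ d ≤ d'. This turns an order between
derivatives into the hypothesis on weights needed one level lower. -/
theorem absMono_sub_of_deriv_le (hf : HasGrowth M V f d) (hf' : HasGrowth M V f' d')
    (hm0 : 0 ≤ m) (hmm : m ≤ m') (hdd : ∀ y, 0 ≤ y → d y ≤ d' y) :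
    AbsMono fun y => m' * f' y - m * f y := by
  have hdiff : ∀ x, HasDerivAt (fun y => m' * f' y - m * f y) (m' * d' x - m * d x) x := fun x =>
    ((hf'.hasDeriv x).const_mul m').sub ((hf.hasDeriv x).const_mul m)
  have h : MonotoneOn (fun y => m' * f' y - m * f y) (Set.Ici 0) := by
    refine monotoneOn_of_deriv_nonneg (convex_Ici 0)
      (fun x _ => (hdiff x).continuousAt.continuousWithinAt)
      (fun x _ => (hdiff x).differentiableAt.differentiableWithinAt) fun x hx => ?_
    rw [interior_Ici] at hx
    have hx' : 0 ≤ x := le_of_lt hx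
    rw [(hdiff x).deriv, sub_nonneg]
    exact mul_le_mul hmm (hdd x hx') (hf.deriv_nonneg hx') (hm0.trans hmm)
  exact AbsMono.of_even (fun x => by simp [hf.even, hf'.even])
    fun x y hx hxy => h hx (hx.trans hxy) hxy

/-- `a ≤ g'` transfers integrability of tilted integrals. -/
theorem Admits.of_le (hf' : HasGrowth M V f' d') (hg' : Admits M V f' g') (hg : AbsMono g)
    (hg0 : ∀ x, 0 ≤ g x) (hgg : ∀ y, g y ≤ g' y) : Admits M V f' g := by
  refine ⟨hg, hg0, fun x => ?_⟩
  have hm := hg.measurable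
  have hc := hf'.continuous
  refine (hg'.integrable x).mono' (Measurable.aestronglyMeasurable (by fun_prop))
    (ae_of_all _ fun z => ?_)
  rw [Real.norm_eq_abs, abs_of_nonneg (mul_nonneg (hg0 _) (Real.exp_pos _).le)]
  exact mul_le_mul_of_nonneg_right (hgg _) (Real.exp_pos _).le

theorem tilt_le_tilt (hf : HasGrowth M (V + v) f d) (hf' : HasGrowth M (V + v) f' d')
    (hm0 : 0 ≤ m) (hmm : m ≤ m') (hm' : m' ≤ M) (hdd : ∀ y, 0 ≤ y → d y ≤ d' y)
    (hg : Admits M (V + v) f g) (hg' : Admits M (V + v) f' g') (hgg : ∀ y, g y ≤ g' y) (x : ℝ) :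
    tilt m v f g x ≤ tilt m' v f' g' x := by
  have hm0' := hm0.trans hmm
  have hm := hmm.trans hm'
  have hgf' := Admits.of_le hf' hg' hg.absMono hg.nonneg hgg
  rw [← (hf.tilt_mono hm0 hm hg).apply_abs x, ← (hf'.tilt_mono hm0' hm' hg').apply_abs x]
  exact tilt_le_of_even hf.even hf'.even hg'.absMono.even
    (absMono_sub_of_deriv_le hf hf' hm0 hmm hdd) hg.absMono hgg (abs_nonneg x) le_rfl
    (hf.integrable_exp hm0 hm _) (hf'.integrable_exp hm0' hm' _)
    (hf.integrable_mul_exp hm0 hm hg _) (hf'.integrable_mul_exp hm0' hm' hgf' _)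
    (hf'.integrable_mul_exp hm0' hm' hg' _)

theorem tilt_deriv_le (hf : HasGrowth M (V + v) f d) (hf' : HasGrowth M (V + v) f' d')
    (hM : 0 < M) (hm0 : 0 ≤ m) (hmm : m ≤ m') (hm' : m' ≤ M) (hdd : ∀ y, 0 ≤ y → d y ≤ d' y)
    {x : ℝ} (hx : 0 ≤ x) : tilt m v f d x ≤ tilt m' v f' d' x := by
  have hm0' := hm0.trans hmm
  have hm := hmm.trans hm'
  have habs : ∀ y, |d y| ≤ |d' y| := fun y => by
    rw [← (absMono_of_odd hf.odd hf.mono).apply_abs y,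
      ← (absMono_of_odd hf'.odd hf'.mono).apply_abs y, abs_of_nonneg
      (hf.deriv_nonneg (abs_nonneg y)), abs_of_nonneg (hf'.deriv_nonneg (abs_nonneg y))]
    exact hdd _ (abs_nonneg y)
  exact tilt_le_of_odd hf.even hf'.even hf.odd hf'.odd
    (absMono_sub_of_deriv_le hf hf' hm0 hmm hdd) hf.mono hdd hx le_rfl
    (hf.integrable_exp hm0 hm _) (hf'.integrable_exp hm0' hm' _)
    (hf.integrable_deriv_mul_exp hM hm0 hm _)
    (hf'.integrable_of_abs_le hm0' hm' (hf'.admits_abs_deriv hM) hf.mono.measurable habs _)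
    (hf'.integrable_deriv_mul_exp hM hm0' hm' _)

end Growth

/-! ### Integrating out one coordinate -/

/-- Resampling one coordinate independently preserves a product law; this gives Fubini in that
coordinate without splitting the index type. -/
theorem measurePreserving_update {ι : Type*} [Fintype ι] [DecidableEq ι] (μ : ι → Measure ℝ)
    [∀ i, IsProbabilityMeasure (μ i)] (i : ι) :
    MeasurePreserving (fun p : (ι → ℝ) × ℝ => Function.update p.1 i p.2)
      ((Measure.pi μ).prod (μ i)) (Measure.pi μ) := by
  have hm : Measurable fun p : (ι → ℝ) × ℝ => Function.update p.1 i p.2 := measurable_update'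
  refine ⟨hm, (Measure.pi_eq fun s hs => ?_).symm⟩
  rw [Measure.map_apply hm (MeasurableSet.univ_pi hs)]
  have e : (fun p : (ι → ℝ) × ℝ => Function.update p.1 i p.2) ⁻¹' Set.univ.pi s
      = (Set.univ.pi (Function.update s i Set.univ)) ×ˢ s i := by
    ext ⟨w, t⟩
    simp only [Set.mem_preimage, Set.mem_pi, Set.mem_univ, forall_const, Set.mem_prod]
    constructor
    · refine fun h => ⟨fun j => ?_, by simpa using h i⟩
      rcases eq_or_ne j i with rfl | hj
      · simp
      · simpa [Function.update_of_ne hj] using h j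
    · rintro ⟨h1, h2⟩ j
      rcases eq_or_ne j i with rfl | hj
      · simpa using h2
      · simpa [Function.update_of_ne hj] using h1 j
  rw [e, Measure.prod_prod, Measure.pi_pi, ← Finset.mul_prod_erase _ _ (Finset.mem_univ i),
    ← Finset.mul_prod_erase Finset.univ (fun j => μ j (s j)) (Finset.mem_univ i),
    Function.update_self, measure_univ, one_mul, mul_comm]
  congr 1
  refine Finset.prod_congr rfl fun j hj => ?_
  rw [Function.update_of_ne (Finset.ne_of_mem_erase hj)]

/-! ### The Gaussian walk and its change of density -/

/-- The walk `x + w_a + … + w_{p-1}`. -/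
def walk {k : ℕ} (a p : ℕ) (x : ℝ) (w : Fin (k + 1) → ℝ) : ℝ :=
  x + ∑ i : Fin (k + 1), if a ≤ (i : ℕ) ∧ (i : ℕ) < p then w i else 0

/-- The density `W_a ⋯ W_{b-1}` along the walk started from `x` at time `a`. -/
def density {k : ℕ} (m : ℕ → ℝ) (f : ℕ → ℝ → ℝ) (a b : ℕ) (x : ℝ) (w : Fin (k + 1) → ℝ) : ℝ :=
  ∏ p ∈ Finset.Ico a b, Real.exp (m p * (f (p + 1) (walk a (p + 1) x w) - f p (walk a p x w)))

theorem walk_self {k : ℕ} (a : ℕ) (x : ℝ) (w : Fin (k + 1) → ℝ) : walk a a x w = x := by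
  unfold walk
  rw [Finset.sum_eq_zero, add_zero]
  intro i _
  rw [if_neg (by omega)]

theorem walk_succ {k a b : ℕ} (hab : a ≤ b) (hb : b < k + 1) (x : ℝ) (w : Fin (k + 1) → ℝ) :
    walk a (b + 1) x w = walk a b x w + w ⟨b, hb⟩ := by
  unfold walk
  rw [add_assoc]
  congr 1
  have e : w ⟨b, hb⟩ = ∑ i : Fin (k + 1), if i = ⟨b, hb⟩ then w i else 0 := by simp
  rw [e, ← Finset.sum_add_distrib]
  refine Finset.sum_congr rfl fun i _ => ?_
  simp only [Fin.ext_iff]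
  split_ifs <;> first | omega | simp

theorem walk_update {k a b p : ℕ} (hp : p ≤ b) (hb : b < k + 1) (x t : ℝ) (w : Fin (k + 1) → ℝ) :
    walk a p x (Function.update w ⟨b, hb⟩ t) = walk a p x w := by
  unfold walk
  congr 1
  refine Finset.sum_congr rfl fun i _ => ?_
  split_ifs with h
  · rw [Function.update_of_ne]
    rintro rfl
    simp only at h
    omega
  · rfl

theorem measurable_walk {k : ℕ} (a p : ℕ) (x : ℝ) :
    Measurable (walk a p x : (Fin (k + 1) → ℝ) → ℝ) := by
  unfold walk
  refine measurable_const.add (Finset.measurable_sum _ fun i _ => ?_)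
  split_ifs
  · exact measurable_pi_apply i
  · exact measurable_const

theorem density_update {k a b : ℕ} (hb : b < k + 1) (m : ℕ → ℝ) (f : ℕ → ℝ → ℝ) (x t : ℝ)
    (w : Fin (k + 1) → ℝ) :
    density m f a b x (Function.update w ⟨b, hb⟩ t) = density m f a b x w := by
  refine Finset.prod_congr rfl fun p hp => ?_
  have := (Finset.mem_Ico.1 hp).2
  rw [walk_update (by omega), walk_update (by omega)]

theorem density_pos {k : ℕ} (m : ℕ → ℝ) (f : ℕ → ℝ → ℝ) (a b : ℕ) (x : ℝ)
    (w : Fin (k + 1) → ℝ) : 0 < density m f a b x w :=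
  Finset.prod_pos fun _ _ => Real.exp_pos _

theorem measurable_density {k : ℕ} (m : ℕ → ℝ) {f : ℕ → ℝ → ℝ} {a b : ℕ} (hb : b ≤ k + 1)
    (hf : ∀ p ≤ k + 1, Measurable (f p)) (x : ℝ) :
    Measurable (density m f a b x : (Fin (k + 1) → ℝ) → ℝ) := by
  unfold density
  refine Finset.measurable_prod _ fun p hp => ?_
  have hp' := (Finset.mem_Ico.1 hp).2
  exact Real.measurable_exp.comp ((((hf (p + 1) (by omega)).comp (measurable_walk a (p + 1) x)).sub
    ((hf p (by omega)).comp (measurable_walk a p x))).const_mul _)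

theorem measurable_tilt {m : ℝ} {v : ℝ≥0} {f g : ℝ → ℝ} (hf : Measurable f) (hg : Measurable g) :
    Measurable (tilt m v f g) := by
  unfold tilt
  refine Measurable.div ?_ ?_
  · exact (StronglyMeasurable.integral_prod_right
      (f := fun x z => g (x + z) * Real.exp (m * f (x + z)))
      (Measurable.stronglyMeasurable (by fun_prop))).measurable
  · exact (StronglyMeasurable.integral_prod_right
      (f := fun x z => Real.exp (m * f (x + z)))
      (Measurable.stronglyMeasurable (by fun_prop))).measurable

theorem HasGrowth.abs_tilt_le {M m : ℝ} {V v : ℝ≥0} {f d g G : ℝ → ℝ}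
    (hf : HasGrowth M (V + v) f d) (hm0 : 0 ≤ m) (hm : m ≤ M) (hG : Admits M (V + v) f G)
    (hg : Measurable g) (hgG : ∀ y, |g y| ≤ G y) (x : ℝ) : |tilt m v f g x| ≤ tilt m v f G x := by
  have hpos := integral_exp_gaussian_pos (hf.integrable_exp hm0 hm x)
  unfold tilt
  rw [abs_div, abs_of_pos hpos]
  refine div_le_div_of_nonneg_right ((abs_integral_le_integral_abs).trans ?_) hpos.le
  refine integral_mono (hf.integrable_of_abs_le hm0 hm hG hg hgG x).abs
    (hf.integrable_mul_exp hm0 hm hG x) fun z => ?_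
  simp only
  rw [abs_mul, Real.abs_exp]
  exact mul_le_mul_of_nonneg_right (hgG _) (Real.exp_pos _).le

/-- By `exp_mul_step`, subtracting the step in the exponent is division by the normalising constant
of the tilt. -/
theorem HasGrowth.integral_density {M m : ℝ} {V v : ℝ≥0} {f d g : ℝ → ℝ}
    (hf : HasGrowth M (V + v) f d) (hm0 : 0 ≤ m) (hm : m ≤ M) (y : ℝ) :
    ∫ t, Real.exp (m * (f (y + t) - Parisi.step m v f y)) * g (y + t) ∂(gaussianReal 0 v)
      = tilt m v f g y := by
  have e : ∀ t, Real.exp (m * (f (y + t) - Parisi.step m v f y)) * g (y + t)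
      = (Real.exp (m * Parisi.step m v f y))⁻¹ * (g (y + t) * Real.exp (m * f (y + t))) := by
    intro t
    rw [mul_sub, Real.exp_sub]
    ring
  simp only [e]
  rw [integral_const_mul, exp_mul_step (hf.integrable_exp hm0 hm y), tilt, inv_mul_eq_div]

/-- The recursion defining the functions `Φ_p`, together with the growth that it propagates. -/
structure IsRecursion (k : ℕ) (M : ℝ) (v : ℕ → ℝ≥0) (m : ℕ → ℝ) (f d : ℕ → ℝ → ℝ) : Prop where
  pos : 0 < M
  nonneg : ∀ p ≤ k, 0 ≤ m p
  le : ∀ p ≤ k, m p ≤ M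
  growth : ∀ p ≤ k + 1, HasGrowth M (∑ i ∈ Finset.range p, v i) (f p) (d p)
  step : ∀ p ≤ k, f p = Parisi.step (m p) (v p) (f (p + 1))
  tilt_eq : ∀ p ≤ k, d p = tilt (m p) (v p) (f (p + 1)) (d (p + 1))

/-! ### Integrating the densities along the walk -/

section Recursion

variable {k : ℕ} {M : ℝ} {v : ℕ → ℝ≥0} {m : ℕ → ℝ} {f d : ℕ → ℝ → ℝ}

theorem IsRecursion.growth_succ (H : IsRecursion k M v m f d) {p : ℕ} (hp : p ≤ k) :
    HasGrowth M (∑ i ∈ Finset.range p, v i + v p) (f (p + 1)) (d (p + 1)) := by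
  rw [← Finset.sum_range_succ]
  exact H.growth (p + 1) (by omega)

theorem IsRecursion.admits_tilt (H : IsRecursion k M v m f d) {p : ℕ} (hp : p ≤ k) {g : ℝ → ℝ}
    (hg : Admits M (∑ i ∈ Finset.range (p + 1), v i) (f (p + 1)) g) :
    Admits M (∑ i ∈ Finset.range p, v i) (f p) (tilt (m p) (v p) (f (p + 1)) g) := by
  rw [Finset.sum_range_succ] at hg
  rw [H.step p hp]
  exact (H.growth_succ hp).admits_tilt H.pos (H.nonneg p hp) (H.le p hp) hg

theorem IsRecursion.measurable (H : IsRecursion k M v m f d) {p : ℕ} (hp : p ≤ k + 1) :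
    Measurable (f p) := (H.growth p hp).continuous.measurable

theorem IsRecursion.density_succ_update (H : IsRecursion k M v m f d) {a b : ℕ} (hab : a ≤ b)
    (hb : b ≤ k) (x t : ℝ) (g : ℝ → ℝ) (w : Fin (k + 1) → ℝ) :
    density m f a (b + 1) x (Function.update w ⟨b, Nat.lt_succ_of_le hb⟩ t) *
        g (walk a (b + 1) x (Function.update w ⟨b, Nat.lt_succ_of_le hb⟩ t))
      = density m f a b x w *
        (Real.exp (m b * (f (b + 1) (walk a b x w + t) -
          Parisi.step (m b) (v b) (f (b + 1)) (walk a b x w))) * g (walk a b x w + t)) := by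
  have e : density m f a (b + 1) x (Function.update w ⟨b, Nat.lt_succ_of_le hb⟩ t)
      = density m f a b x (Function.update w ⟨b, Nat.lt_succ_of_le hb⟩ t) *
        Real.exp (m b * (f (b + 1) (walk a (b + 1) x
          (Function.update w ⟨b, Nat.lt_succ_of_le hb⟩ t)) -
          f b (walk a b x (Function.update w ⟨b, Nat.lt_succ_of_le hb⟩ t)))) :=
    Finset.prod_Ico_succ_top hab _
  rw [e, density_update, walk_succ hab (Nat.lt_succ_of_le hb), walk_update le_rfl,
    Function.update_self, H.step b hb, mul_assoc]

/-- Induction on b by Tonelli: integrating the absolute value over the last coordinate leaves the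
tilt of |g|, which is dominated by the tilt of G, admissible one level lower. -/
theorem IsRecursion.integrable_density (H : IsRecursion k M v m f d) {a b : ℕ} (hab : a ≤ b)
    (hb : b ≤ k + 1) (x : ℝ) {g G : ℝ → ℝ} (hg : Measurable g) (hgG : ∀ y, |g y| ≤ G y)
    (hG : Admits M (∑ i ∈ Finset.range b, v i) (f b) G) :
    Integrable (fun w : Fin (k + 1) → ℝ => density m f a b x w * g (walk a b x w))
      (Measure.pi fun i : Fin (k + 1) => gaussianReal 0 (v i)) := by
  induction b, hab using Nat.le_induction generalizing g G with
  | base => simp [density, walk_self]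
  | succ b hab ih =>
    have hb' : b ≤ k := by omega
    have hmp := measurePreserving_update (fun i : Fin (k + 1) => gaussianReal 0 (v i))
      ⟨b, Nat.lt_succ_of_le hb'⟩
    have hmeas : Measurable fun w : Fin (k + 1) → ℝ =>
        density m f a (b + 1) x w * g (walk a (b + 1) x w) :=
      (measurable_density m hb (fun p hp => H.measurable hp) x).mul
        (hg.comp (measurable_walk a (b + 1) x))
    rw [← hmp.integrable_comp hmeas.aestronglyMeasurable, integrable_prod_iff
      (hmeas.comp hmp.measurable).aestronglyMeasurable]
    simp only [Function.comp_def, H.density_succ_update hab hb', norm_mul, Real.norm_eq_abs,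
      Real.abs_exp, abs_of_pos (density_pos m f a b x _), integral_const_mul]
    have hG' := hG
    rw [Finset.sum_range_succ] at hG'
    have hf := H.growth_succ hb'
    refine ⟨ae_of_all _ fun w => ?_, ?_⟩
    · have i1 := hf.integrable_of_abs_le (H.nonneg b hb') (H.le b hb') hG' hg hgG (walk a b x w)
      have i2 := i1.const_mul (Real.exp (-(m b *
        Parisi.step (m b) (v b) (f (b + 1)) (walk a b x w))))
      refine Integrable.const_mul (i2.congr (ae_of_all _ fun t => ?_)) _
      simp only
      rw [mul_sub, sub_eq_add_neg, Real.exp_add]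
      ring
    · have hga : Measurable fun y => |g y| := measurable_abs.comp hg
      have := ih (by omega) (g := tilt (m b) (v b) (f (b + 1)) fun y => |g y|)
        (measurable_tilt (H.measurable hb) hga)
        (hf.abs_tilt_le (H.nonneg b hb') (H.le b hb') hG' hga
          (fun y => (abs_abs (g y)).trans_le (hgG y))) (H.admits_tilt hb' hG)
      refine this.congr (ae_of_all _ fun w => ?_)
      simp only
      rw [← hf.integral_density (H.nonneg b hb') (H.le b hb')]

theorem IsRecursion.integral_density_succ (H : IsRecursion k M v m f d) {a b : ℕ} (hab : a ≤ b)
    (hb : b ≤ k) (x : ℝ) {g G : ℝ → ℝ} (hg : Measurable g) (hgG : ∀ y, |g y| ≤ G y)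
    (hG : Admits M (∑ i ∈ Finset.range (b + 1), v i) (f (b + 1)) G) :
    ∫ w : Fin (k + 1) → ℝ, density m f a (b + 1) x w * g (walk a (b + 1) x w)
        ∂(Measure.pi fun i : Fin (k + 1) => gaussianReal 0 (v i))
      = ∫ w : Fin (k + 1) → ℝ, density m f a b x w *
        tilt (m b) (v b) (f (b + 1)) g (walk a b x w)
        ∂(Measure.pi fun i : Fin (k + 1) => gaussianReal 0 (v i)) := by
  have hmp := measurePreserving_update (fun i : Fin (k + 1) => gaussianReal 0 (v i))
    ⟨b, Nat.lt_succ_of_le hb⟩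
  have hi := H.integrable_density (by omega : a ≤ b + 1) (by omega) x hg hgG hG
  have hi' : Integrable (fun p : (Fin (k + 1) → ℝ) × ℝ =>
      density m f a (b + 1) x (Function.update p.1 ⟨b, Nat.lt_succ_of_le hb⟩ p.2) *
        g (walk a (b + 1) x (Function.update p.1 ⟨b, Nat.lt_succ_of_le hb⟩ p.2)))
      ((Measure.pi fun i : Fin (k + 1) => gaussianReal 0 (v i)).prod (gaussianReal 0 (v b))) :=
    hmp.integrable_comp_of_integrable hi
  have e := integral_map (μ := (Measure.pi fun i : Fin (k + 1) => gaussianReal 0 (v i)).prod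
    (gaussianReal 0 (v b))) hmp.measurable.aemeasurable
    (f := fun w => density m f a (b + 1) x w * g (walk a (b + 1) x w))
    (by rw [hmp.map_eq]; exact hi.aestronglyMeasurable)
  rw [hmp.map_eq] at e
  rw [e, integral_prod _ hi']
  refine integral_congr_ae (ae_of_all _ fun w => ?_)
  simp only [H.density_succ_update hab hb, integral_const_mul]
  rw [(H.growth_succ hb).integral_density (H.nonneg b hb) (H.le b hb)]

/-- A family that is invariant under the tilted expectations is a martingale for the densities. -/
theorem IsRecursion.integral_density_eq (H : IsRecursion k M v m f d) {a b : ℕ} (hab : a ≤ b)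
    (hb : b ≤ k + 1) (x : ℝ) {g G : ℕ → ℝ → ℝ}
    (hg : ∀ p ≤ b, Measurable (g p)) (hgG : ∀ p ≤ b, ∀ y, |g p y| ≤ G p y)
    (hG : ∀ p ≤ b, Admits M (∑ i ∈ Finset.range p, v i) (f p) (G p))
    (hs : ∀ p < b, g p = tilt (m p) (v p) (f (p + 1)) (g (p + 1))) :
    ∫ w : Fin (k + 1) → ℝ, density m f a b x w * g b (walk a b x w)
        ∂(Measure.pi fun i : Fin (k + 1) => gaussianReal 0 (v i)) = g a x := by
  induction b, hab using Nat.le_induction with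
  | base => simp [density, walk_self]
  | succ b hab ih =>
    rw [H.integral_density_succ hab (by omega) x (hg (b + 1) le_rfl) (hgG (b + 1) le_rfl)
      (hG (b + 1) le_rfl), ← hs b (by omega)]
    exact ih (by omega) (fun p hp => hg p (by omega)) (fun p hp => hgG p (by omega))
      (fun p hp => hG p (by omega)) fun p hp => hs p (by omega)

/-! ### Iterated tilted expectations -/

/-- `tiltIter … b g n` is the function `g` after the tilted expectations at the levels
`b - 1, …, b - n`. -/
def tiltIter (v : ℕ → ℝ≥0) (m : ℕ → ℝ) (f : ℕ → ℝ → ℝ) (b : ℕ) (g : ℝ → ℝ) : ℕ → ℝ → ℝ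
  | 0 => g
  | n + 1 => tilt (m (b - (n + 1))) (v (b - (n + 1))) (f (b - (n + 1) + 1)) (tiltIter v m f b g n)

theorem tiltIter_step (v : ℕ → ℝ≥0) (m : ℕ → ℝ) (f : ℕ → ℝ → ℝ) {b p : ℕ} (g : ℝ → ℝ)
    (hp : p < b) : tiltIter v m f b g (b - p)
      = tilt (m p) (v p) (f (p + 1)) (tiltIter v m f b g (b - (p + 1))) := by
  have h1 : b - p = b - (p + 1) + 1 := by omega
  have h2 : b - (b - (p + 1) + 1) = p := by omega
  rw [h1, tiltIter, h2]

theorem IsRecursion.admits_tiltIter (H : IsRecursion k M v m f d) {b : ℕ} (hb : b ≤ k + 1)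
    {g : ℝ → ℝ} (hg : Admits M (∑ i ∈ Finset.range b, v i) (f b) g) {p : ℕ} (hp : p ≤ b) :
    Admits M (∑ i ∈ Finset.range p, v i) (f p) (tiltIter v m f b g (b - p)) := by
  induction hn : b - p generalizing p with
  | zero =>
    obtain rfl : p = b := by omega
    exact hg
  | succ n ih =>
    have h := ih (p := p + 1) (by omega) (by omega)
    have e := tiltIter_step v m f g (by omega : p < b)
    rw [hn, show b - (p + 1) = n by omega] at e
    rw [e]
    exact H.admits_tilt (by omega) h

theorem IsRecursion.integral_density_tiltIter (H : IsRecursion k M v m f d) {a b : ℕ}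
    (hab : a ≤ b) (hb : b ≤ k + 1) (x : ℝ) {g : ℝ → ℝ}
    (hg : Admits M (∑ i ∈ Finset.range b, v i) (f b) g) :
    ∫ w : Fin (k + 1) → ℝ, density m f a b x w * g (walk a b x w)
        ∂(Measure.pi fun i : Fin (k + 1) => gaussianReal 0 (v i))
      = tiltIter v m f b g (b - a) x := by
  have hA := fun p (hp : p ≤ b) => H.admits_tiltIter hb hg hp
  have := H.integral_density_eq hab hb x (g := fun p => tiltIter v m f b g (b - p))
    (G := fun p => tiltIter v m f b g (b - p)) (fun p hp => (hA p hp).absMono.measurable)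
    (fun p hp y => (abs_of_nonneg ((hA p hp).nonneg y)).le) hA
    fun p hp => tiltIter_step v m f g hp
  simpa only [Nat.sub_self, tiltIter] using this

variable {m' : ℕ → ℝ} {f' d' : ℕ → ℝ → ℝ}

/-- Downward induction from the common top derivative: the order at level p + 1 makes the weight
ratio monotone, and the odd comparison returns the order at level p. -/
theorem IsRecursion.deriv_le (H : IsRecursion k M v m f d) (H' : IsRecursion k M v m' f' d')
    (hmm : ∀ p ≤ k, m p ≤ m' p) (htop : d (k + 1) = d' (k + 1)) {p : ℕ} (hp : p ≤ k + 1) :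
    ∀ x, 0 ≤ x → d p x ≤ d' p x := by
  induction hn : k + 1 - p generalizing p with
  | zero =>
    obtain rfl : p = k + 1 := by omega
    intro x _
    rw [htop]
  | succ n ih =>
    intro x hx
    have hp' : p ≤ k := by omega
    rw [H.tilt_eq p hp', H'.tilt_eq p hp']
    exact tilt_deriv_le (H.growth_succ hp') (H'.growth_succ hp') H.pos (H.nonneg p hp')
      (hmm p hp') (H'.le p hp') (ih (by omega) (by omega)) hx

theorem IsRecursion.tiltIter_le (H : IsRecursion k M v m f d) (H' : IsRecursion k M v m' f' d')
    (hmm : ∀ p ≤ k, m p ≤ m' p) (htop : d (k + 1) = d' (k + 1)) {b : ℕ} (hb : b ≤ k + 1)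
    {g g' : ℝ → ℝ} (hg : Admits M (∑ i ∈ Finset.range b, v i) (f b) g)
    (hg' : Admits M (∑ i ∈ Finset.range b, v i) (f' b) g') (hgg : ∀ y, g y ≤ g' y) {p : ℕ}
    (hp : p ≤ b) (x : ℝ) : tiltIter v m f b g (b - p) x ≤ tiltIter v m' f' b g' (b - p) x := by
  induction hn : b - p generalizing p x with
  | zero => exact hgg x
  | succ n ih =>
    have hp' : p ≤ k := by omega
    have h1 := H.admits_tiltIter hb hg (by omega : p + 1 ≤ b)
    have h2 := H'.admits_tiltIter hb hg' (by omega : p + 1 ≤ b)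
    rw [Finset.sum_range_succ] at h1 h2
    have hle := fun y => ih (p := p + 1) (by omega) y (by omega)
    rw [← hn, tiltIter_step v m f g (by omega : p < b), tiltIter_step v m' f' g' (by omega : p < b)]
    rw [show n = b - (p + 1) by omega] at hle
    exact tilt_le_tilt (H.growth_succ hp') (H'.growth_succ hp') (H.nonneg p hp') (hmm p hp')
      (H'.le p hp') (H.deriv_le H' hmm htop (by omega)) h1 h2 hle x

end Recursion

/-! ### Admissible functions -/

theorem IsAdmissible.hasDeriv {f : ℝ → ℝ} (hf : IsAdmissible f) (x : ℝ) :
    HasDerivAt f (deriv f x) x :=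
  (hf.smooth.differentiable (by simp) x).hasDerivAt

theorem IsAdmissible.deriv_odd {f : ℝ → ℝ} (hf : IsAdmissible f) (x : ℝ) :
    deriv f (-x) = -deriv f x := by
  have h := deriv_comp_neg (f := f) x
  rw [funext hf.even] at h
  linarith

theorem IsAdmissible.deriv_mono {f : ℝ → ℝ} (hf : IsAdmissible f) : Monotone (deriv f) :=
  monotoneOn_univ.1 (hf.convex.monotoneOn_deriv
    fun x _ => hf.smooth.differentiable (by simp) x)

theorem IsAdmissible.nonneg {f : ℝ → ℝ} (hf : IsAdmissible f) (x : ℝ) : 0 ≤ f x := by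
  have h := hf.convex.2 (Set.mem_univ x) (Set.mem_univ (-x)) (by norm_num : (0 : ℝ) ≤ 1 / 2)
    (by norm_num : (0 : ℝ) ≤ 1 / 2) (by norm_num)
  simp only [smul_eq_mul, hf.even] at h
  rw [show 1 / 2 * x + 1 / 2 * -x = 0 by ring, hf.zero] at h
  linarith

/-- Telescoping; the truncation in `incrVar` is harmless because ξ' is nondecreasing with ξ'(0) = 0.
At n = k + 1 the total is ξ'(1), the variance in the growth assumption. -/
theorem sum_incrVar {ξ : ℝ → ℝ} (hξ : IsAdmissible ξ) {k : ℕ} {q : ℕ → ℝ} (hq : IsPartition k q)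
    {n : ℕ} (hn : n ≤ k + 1) :
    0 ≤ deriv ξ (q n) ∧ ∑ i ∈ Finset.range n, incrVar ξ q i = (deriv ξ (q n)).toNNReal := by
  induction n with
  | zero => simp [hq.zero, odd_zero hξ.deriv_odd]
  | succ n ih =>
    obtain ⟨h1, h2⟩ := ih (by omega)
    have h3 := hξ.deriv_mono (hq.mono n (by omega))
    refine ⟨h1.trans h3, ?_⟩
    rw [Finset.sum_range_succ, h2, incrVar, ← Real.toNNReal_add h1 (sub_nonneg.2 h3),
      add_sub_cancel]

theorem IsOrderSeq.nonneg {k : ℕ} {M : ℝ} {m : ℕ → ℝ} (hm : IsOrderSeq k M m) {p : ℕ}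
    (hp : p ≤ k) : 0 ≤ m p := by
  induction p with
  | zero => exact hm.zero.ge
  | succ p ih => exact (ih (by omega)).trans (hm.mono p (by omega))

theorem IsOrderSeq.le_top {k : ℕ} {M : ℝ} {m : ℕ → ℝ} (hm : IsOrderSeq k M m) {p : ℕ}
    (hp : p ≤ k) : m p ≤ M := by
  induction hn : k - p generalizing p with
  | zero =>
    obtain rfl : p = k := by omega
    exact hm.le
  | succ n ih => exact (hm.mono p (by omega)).trans (ih (by omega) (by omega))

/-! ### The Parisi recursion -/

variable {Φ ξ : ℝ → ℝ} {M h : ℝ} {k l : ℕ} {q m : ℕ → ℝ}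

theorem hasGrowth_phi (hΦ : IsAdmissible Φ) (hξ : IsAdmissible ξ) (hM : 0 < M)
    (hgrowth : ModerateGrowth Φ ξ M) (hq : IsPartition k q) (hm : IsOrderSeq k M m) {p : ℕ}
    (hp : p ≤ k + 1) :
    HasGrowth M (∑ i ∈ Finset.range p, incrVar ξ q i) (phi k Φ ξ q m p)
      (deriv (phi k Φ ξ q m p)) := by
  induction hn : k + 1 - p generalizing p with
  | zero =>
    obtain rfl : p = k + 1 := by omega
    rw [phi_last, (sum_incrVar hξ hq le_rfl).2, hq.last]
    exact ⟨hΦ.hasDeriv, hΦ.deriv_odd, hΦ.deriv_mono, hΦ.even, hΦ.nonneg, hgrowth⟩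
  | succ n ih =>
    have hp' : p ≤ k := by omega
    have h1 := ih (p := p + 1) (by omega) (by omega)
    rw [Finset.sum_range_succ] at h1
    have h2 := h1.step hM (hm.nonneg hp') (hm.le_top hp')
    have h3 : deriv (phi k Φ ξ q m p) = tilt (m p) (incrVar ξ q p) (phi k Φ ξ q m (p + 1))
        (deriv (phi k Φ ξ q m (p + 1))) := by
      rw [phi_of_le k Φ ξ q m hp']
      exact funext fun x => (h2.hasDeriv x).deriv
    rw [h3, phi_of_le k Φ ξ q m hp']
    exact h2

theorem isRecursion_phi (hΦ : IsAdmissible Φ) (hξ : IsAdmissible ξ) (hM : 0 < M)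
    (hgrowth : ModerateGrowth Φ ξ M) (hq : IsPartition k q) (hm : IsOrderSeq k M m) :
    IsRecursion k M (incrVar ξ q) m (phi k Φ ξ q m) fun p => deriv (phi k Φ ξ q m p) where
  pos := hM
  nonneg _ hp := hm.nonneg hp
  le _ hp := hm.le_top hp
  growth _ hp := hasGrowth_phi hΦ hξ hM hgrowth hq hm hp
  step _ hp := phi_of_le k Φ ξ q m hp
  tilt_eq p hp := by
    have h1 := hasGrowth_phi hΦ hξ hM hgrowth hq hm (by omega : p + 1 ≤ k + 1)
    rw [Finset.sum_range_succ] at h1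
    rw [phi_of_le k Φ ξ q m hp]
    exact funext fun x => (h1.step_hasDeriv hM (hm.nonneg hp) (hm.le_top hp) x).deriv

theorem Z_eq_walk (h : ℝ) (p : ℕ) (z : Fin (k + 1) → ℝ) : Z h p z = walk 0 p h z := by
  simp [Z, walk]

theorem Z_splice {p : ℕ} (hp : l ≤ p) (h : ℝ) (z w : Fin (k + 1) → ℝ) :
    Z h p (splice l z w) = walk l p (Z h l z) w := by
  unfold Z walk splice
  rw [add_assoc, ← Finset.sum_add_distrib]
  congr 1
  refine Finset.sum_congr rfl fun i _ => ?_
  split_ifs <;> first | omega | simp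

theorem inner_splice (hl : l ≤ k) (z w : Fin (k + 1) → ℝ) :
    inner k Φ ξ h q m l (splice l z w) =
      density m (phi k Φ ξ q m) l (k + 1) (Z h l z) w *
        deriv (phi k Φ ξ q m (k + 1)) (walk l (k + 1) (Z h l z) w) := by
  rw [inner, Z_splice (by omega), phi_last]
  congr 1
  rw [density, Finset.Ico_add_one_right_eq_Icc]
  refine Finset.prod_congr rfl fun p hp => ?_
  have := (Finset.mem_Icc.1 hp).1
  rw [W, X, X, Z_splice this, Z_splice (by omega)]

/-- The derivatives Φ_p' are fixed by the tilted means, so they form a martingale for the densities,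
and conditioning on the first l variables leaves Φ_l'. -/
theorem IsRecursion.partialExp_inner
    (H : IsRecursion k M (incrVar ξ q) m (phi k Φ ξ q m) fun p => deriv (phi k Φ ξ q m p))
    (hl : l ≤ k) (z : Fin (k + 1) → ℝ) :
    partialExp k ξ q l (inner k Φ ξ h q m l) z = deriv (phi k Φ ξ q m l) (Z h l z) := by
  simp only [partialExp, inner_splice hl, law]
  exact H.integral_density_eq (by omega) le_rfl _
    (g := fun p => deriv (phi k Φ ξ q m p)) (G := fun p y => |deriv (phi k Φ ξ q m p) y|)
    (fun p hp => (H.growth p hp).mono.measurable) (fun _ _ _ => le_rfl)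
    (fun p hp => (H.growth p hp).admits_abs_deriv H.pos) fun p hp => H.tilt_eq p (by omega)

theorem IsRecursion.outer_eq
    (H : IsRecursion k M (incrVar ξ q) m (phi k Φ ξ q m) fun p => deriv (phi k Φ ξ q m p))
    (hm0 : m 0 = 0) (hl1 : 1 ≤ l) (hl : l ≤ k) :
    outer k Φ ξ h q m l = fun z => density m (phi k Φ ξ q m) 0 l h z *
      deriv (phi k Φ ξ q m l) (walk 0 l h z) ^ 2 := by
  funext z
  -- The density starts at level 0 while `outer` starts at level 1; the extra factor W_0 is 1
  -- because m_0 = 0.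
  rw [outer, H.partialExp_inner hl, Z_eq_walk, density, Finset.prod_eq_prod_Ico_succ_bot hl1, hm0,
    zero_mul, Real.exp_zero, one_mul]
  simp only [W, X, Z_eq_walk]

theorem IsRecursion.wellDefined
    (H : IsRecursion k M (incrVar ξ q) m (phi k Φ ξ q m) fun p => deriv (phi k Φ ξ q m p))
    (hm0 : m 0 = 0) (hl1 : 1 ≤ l) (hl : l ≤ k) : WellDefined k Φ ξ h q m l where
  phi_integrable _ hp x := (H.growth_succ hp).integrable_self H.pos x
  exp_integrable p hp x := (H.growth_succ hp).integrable_exp (H.nonneg p hp) (H.le p hp) x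
  inner_integrable z := by
    simp only [inner_splice hl]
    exact H.integrable_density (by omega) le_rfl _ (H.growth (k + 1) le_rfl).mono.measurable
      (fun _ => le_rfl) ((H.growth (k + 1) le_rfl).admits_abs_deriv H.pos)
  outer_integrable := by
    rw [H.outer_eq hm0 hl1 hl]
    have hA := (H.growth l (by omega)).admits_sq_deriv H.pos
    exact H.integrable_density (by omega) (by omega) h hA.absMono.measurable
      (fun y => (abs_of_nonneg (hA.nonneg y)).le) hA

theorem IsRecursion.U_eq
    (H : IsRecursion k M (incrVar ξ q) m (phi k Φ ξ q m) fun p => deriv (phi k Φ ξ q m p))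
    (hm0 : m 0 = 0) (hl1 : 1 ≤ l) (hl : l ≤ k) :
    U k Φ ξ h q m l = tiltIter (incrVar ξ q) m (phi k Φ ξ q m) l
      (fun y => deriv (phi k Φ ξ q m l) y ^ 2) (l - 0) h := by
  rw [U, H.outer_eq hm0 hl1 hl]
  exact H.integral_density_tiltIter (Nat.zero_le l) (by omega) h
    ((H.growth l (by omega)).admits_sq_deriv H.pos)

/-- `U_l` is nondecreasing for the coordinatewise order on the vectors `m`. -/
theorem IsRecursion.U_le {m' : ℕ → ℝ}
    (H : IsRecursion k M (incrVar ξ q) m (phi k Φ ξ q m) fun p => deriv (phi k Φ ξ q m p))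
    (H' : IsRecursion k M (incrVar ξ q) m' (phi k Φ ξ q m') fun p => deriv (phi k Φ ξ q m' p))
    (hm0 : m 0 = 0) (hm0' : m' 0 = 0) (hmm : ∀ p ≤ k, m p ≤ m' p) (hl1 : 1 ≤ l) (hl : l ≤ k) :
    U k Φ ξ h q m l ≤ U k Φ ξ h q m' l := by
  have htop : deriv (phi k Φ ξ q m (k + 1)) = deriv (phi k Φ ξ q m' (k + 1)) := by
    rw [phi_last, phi_last]
  rw [H.U_eq hm0 hl1 hl, H'.U_eq hm0' hl1 hl]
  have hf := H.growth l (by omega)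
  have hf' := H'.growth l (by omega)
  refine H.tiltIter_le H' hmm htop (by omega) (hf.admits_sq_deriv H.pos)
    (hf'.admits_sq_deriv H.pos) (fun y => ?_) (Nat.zero_le l) h
  -- The derivatives are ordered only on the half-line; their squares are even, so passing to |y|
  -- suffices.
  rw [← (hf.admits_sq_deriv H.pos).absMono.apply_abs,
    ← (hf'.admits_sq_deriv H.pos).absMono.apply_abs]
  exact pow_le_pow_left₀ (hf.deriv_nonneg (abs_nonneg y))
    (H.deriv_le H' hmm htop (by omega) _ (abs_nonneg y)) 2

end Parisi

end

theorem theorem2 (Φ ξ : ℝ → ℝ) (hΦ : Parisi.IsAdmissible Φ) (hξ : Parisi.IsAdmissible ξ)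
    (M : ℝ) (hM : 0 < M) (hgrowth : Parisi.ModerateGrowth Φ ξ M)
    (h : ℝ) (k : ℕ) (hk : 1 ≤ k) (q : ℕ → ℝ) (hq : Parisi.IsPartition k q)
    (l : ℕ) (hl1 : 1 ≤ l) (hlk : l ≤ k) :
    (∀ m : ℕ → ℝ, Parisi.IsOrderSeq k M m → Parisi.WellDefined k Φ ξ h q m l) ∧
    (∀ j : ℕ, 1 ≤ j → j ≤ k → ∀ (m : ℕ → ℝ) (t : ℝ), m j ≤ t →
      Parisi.IsOrderSeq k M m → Parisi.IsOrderSeq k M (Function.update m j t) →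
      Parisi.U k Φ ξ h q m l ≤ Parisi.U k Φ ξ h q (Function.update m j t) l) := by
  refine ⟨fun m hm => (Parisi.isRecursion_phi hΦ hξ hM hgrowth hq hm).wellDefined hm.zero hl1 hlk,
    fun j _ _ m t hjt hm hm' => ?_⟩
  refine (Parisi.isRecursion_phi hΦ hξ hM hgrowth hq hm).U_le
    (Parisi.isRecursion_phi hΦ hξ hM hgrowth hq hm') hm.zero hm'.zero (fun p _ => ?_) hl1 hlk
  rcases eq_or_ne p j with rfl | hp
  · simpa using hjt
  · rw [Function.update_of_ne hp]
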